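/- Let $k\ge 1$ be an integer. For $d\ge1$, $t>0$ and $\delta\in(0,\tfrac14)$ put $W=[-\tfrac12,\tfrac12]^d$ and let $\eta$ be a Poisson point process in $W$ with intensity measure $t\,\Lambda_d|_W$, where $\Lambda_d$ is Lebesgue measure. For a counting measure $\chi$ on $\mathbb R^d$ put $$F_k(\chi)=\frac1{(k+1)!}\sum_{(y_0,\dots,y_k)\in\chi^{k+1}_{\neq}}\ \prod_{0\le i<j\le k}\mathbf 1\{\|y_j-y_i\|_\infty\le\delta\},$$ where $\chi^{k+1}_{\neq}$ is the collection of $(k+1)$-tuples of pairwise distinct points of $\chi$ (points of mass $m$ being regarded as $m$ distinct points). Then $F_k=F_k(\eta)$ is the number of $k$-simplices of the Vietoris-Rips complex of $\eta$ with parameter $\delta$ with respect to the uniform norm. Put $$D_xF_k=F_k(\eta+\delta_x)-F_k(\eta),$$ $$D^2_{x_1,x_2}F_k=F_k(\eta+\delta_{x_1}+\delta_{x_2})-F_k(\eta+\delta_{x_1})-F_k(\eta+\delta_{x_2})+F_k(\eta),$$ where $\delta_x$ is the Dirac measure at $x$. a) For each $p\in\{2,3,4\}$ there is a constant $D_p(k)\in(0,\infty)$,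 depending only on $k$ and $p$, such that for all $d\ge1$, $t>0$, $\delta\in(0,\tfrac14)$ and all $x\in W$ $$\mathbb E[(D_xF_k)^p]\le D_p(k)\sum_{q=k}^{pk}(t\delta^d)^q\Bigl((k+1)\bigl(\tfrac{q-k}{p-1}+1\bigr)^{p-1}\Bigr)^d .$$ b) There is a constant $D_4^*(k)\in(0,\infty)$, depending only on $k$, such that for all $d\ge1$, $t>0$, $\delta\in(0,\tfrac14)$ and all $x\in W$ $$\mathbb E\bigl[\bigl(D_xF_k\,(D_xF_k-1)\bigr)^2\bigr]\le D_4^*(k)\sum_{q=k+1}^{4k}(t\delta^d)^q\Bigl((k+1)\bigl(\tfrac{q-k}{3}+1\bigr)^{3}\Bigr)^d .$$ c) There is a constant $D_4'(k)\in(0,\infty)$, depending only on $k$, such that for all $d\ge1$, $t>0$, $\delta\in(0,\tfrac14)$ and all $x_1,x_2\in W$ $$\mathbb E\bigl[(D^2_{x_1,x_2}F_k)^4\bigr]\le \mathbf 1\{\|x_1-x_2\|_\infty\le\delta\}\,D_4'(k)\sum_{q=k-1}^{4(k-1)}(t\delta^d)^q\Bigl(k\bigl(\tfrac{q-(k-1)}{3}+1\bigr)^{3}\Bigr)^d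 .$$ All these moments exist and are finite. -/

import Mathlib

open MeasureTheory ProbabilityTheory

noncomputable section

namespace PoissonRips

/-- Points of `ℝ^d`. The norm is the uniform (maximum) norm, the measurable space is the Borel one
and `volume` is Lebesgue measure. -/
abbrev Pt (d : ℕ) : Type := Fin d → ℝ

/-- The observation window `W = [-1/2, 1/2]^d`. -/
def window (d : ℕ) : Set (Pt d) := Set.Icc (fun _ => -(1 / 2 : ℝ)) (fun _ => (1 / 2 : ℝ))

/-- A `σ`-finite counting measure: a `σ`-finite measure with values in `ℕ ∪ {∞}`. -/
structure IsCountingMeasure {E : Type*} [MeasurableSpace E] (χ : Measure E) : Prop where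
  sigmaFinite : SigmaFinite χ
  integer_valued : ∀ B : Set E, MeasurableSet B → ∃ n : ℕ∞, χ B = (n : ENNReal)

/-- `η` is a Poisson point process with intensity measure `μ` on the probability space `(Ω, P)`:
a random element of the space of `σ`-finite counting measures (with the `σ`-field generated by the
evaluations `χ ↦ χ B`) such that `η(B)` is Poisson distributed with mean `μ(B)`, and such that the
values on pairwise disjoint sets are independent. If `μ(B) = ∞`, then every finite value of `η(B)`
has probability zero. -/
structure IsPoissonPointProcess {E : Type*} [MeasurableSpace E] {Ω : Type*} [MeasurableSpace Ω]
    (P : Measure Ω) (η : Ω → Measure E) (μ : Measure E) : Prop where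
  measurable : Measurable η
  counting : ∀ ω, IsCountingMeasure (η ω)
  poisson : ∀ B : Set E, MeasurableSet B → ∀ n : ℕ,
    P {ω | η ω B = (n : ENNReal)} = if μ B = ⊤ then 0 else poissonMeasure (μ B).toNNReal {n}
  indep : ∀ (m : ℕ) (B : Fin m → Set E), (∀ i, MeasurableSet (B i)) →
    Pairwise (fun i j => Disjoint (B i) (B j)) → iIndepFun (fun i ω => η ω (B i)) P

/-- The points charged by `χ`, each listed according to its multiplicity: a point `y` of mass
`χ {y} = m` gives the `m` labelled points `(y, 0), …, (y, m - 1)`. If `χ` is simple, these are just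
the points charged by `χ`. -/
def Atom {E : Type*} [MeasurableSpace E] (χ : Measure E) : Type _ :=
  {a : E × ℕ // (a.2 : ENNReal) < χ {a.1}}

/-- `χ^n_≠`: the `n`-tuples of pairwise distinct points charged by `χ` (counted with
multiplicity). -/
def DistinctTuple {E : Type*} [MeasurableSpace E] (χ : Measure E) (n : ℕ) : Type _ :=
  {y : Fin n → Atom χ // Function.Injective y}

/-- The underlying points of a tuple. -/
def DistinctTuple.points {E : Type*} [MeasurableSpace E] {χ : Measure E} {n : ℕ}
    (y : DistinctTuple χ n) : Fin n → E :=
  fun i => (y.1 i).1.1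

/-- The indicator that all pairwise uniform distances of `y_0, …, y_{n-1}` are at most `δ`. -/
def closeIndicator {d : ℕ} (δ : ℝ) {n : ℕ} (y : Fin n → Pt d) : ℝ :=
  ∏ i : Fin n, ∏ j ∈ Finset.Ioi i, if ‖y j - y i‖ ≤ δ then 1 else 0

/-- The `k`-simplex counting functional `F_k` of the Vietoris-Rips complex with parameter `δ` with
respect to the uniform norm, as a function (representative) of the point configuration `χ`. -/
def simplexCount {d : ℕ} (δ : ℝ) (k : ℕ) (χ : Measure (Pt d)) : ℝ :=
  1 / ((k + 1).factorial : ℝ) * ∑' y : DistinctTuple χ (k + 1), closeIndicator δ y.points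

/-- The first order difference (add-one-cost) operator: `D_x f (χ) = f (χ + δ_x) - f χ`. -/
def diffOp {E : Type*} [MeasurableSpace E] (x : E) (f : Measure E → ℝ) : Measure E → ℝ :=
  fun χ => f (χ + Measure.dirac x) - f χ

/-- The second order difference operator `D²_{x₁,x₂} f = D_{x₁} (D_{x₂} f)`. -/
def diffOp₂ {E : Type*} [MeasurableSpace E] (x₁ x₂ : E) (f : Measure E → ℝ) : Measure E → ℝ :=
  diffOp x₁ (diffOp x₂ f)

/-- `η` is the stationary Poisson point process of intensity `t` in the window `W`: its intensity
measure is `t` times Lebesgue measure on `W`. -/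
def IsWindowProcess {d : ℕ} {Ω : Type*} [MeasurableSpace Ω]
    (P : Measure Ω) (η : Ω → Measure (Pt d)) (t : ℝ) : Prop :=
  IsPoissonPointProcess P η (ENNReal.ofReal t • (volume : Measure (Pt d)).restrict (window d))

end PoissonRips

end

open PoissonRips

universe u

/-! Adding a point `x` creates exactly the simplices that contain `x`, so `D_x F_k` is the number of
`k`-cliques of `η` in the `δ`-ball around `x`. Likewise `D²` counts the `(k-1)`-cliques near both
points if these are `δ`-close, and vanishes otherwise. A `p`-th power of such a count is the number
of `p`-tuples of `k`-cliques. Sorted by the size `q` of the union and by the pattern in which the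
blocks cover it (finitely many, depending only on `k` and `p`), these become `q`-tuples of distinct
points. For (b), `(N(N-1))²` counts quadruples with two prescribed inequalities, which forces `q ≥ k
+ 1`. `CountsTuples` covers all cases at once.

The expected number of such `q`-tuples is `t^q` times a volume which, for the uniform norm, is a
product over the `d` coordinates. In one coordinate, `n` points within `δ` of the root and of each
other fill a volume of at most `(n+1) δ^n`. Splitting the `q` points into subsets of the blocks,
with one whole block of size `k`, and applying AM-GM to the other `p - 1` sizes gives `(k+1)
((q-k)/(p-1) + 1)^(p-1)` (`card_blockInts_le`).

Expectations are computed on a grid of mesh `1/s`: cell counts are independent Poisson variables,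
their factorial moments give the expected number of tuples (`lintegral_card_embeddings_poisson`),
and volumes become counts of lattice points. Coarsening distances to cells can only enlarge the
count, so each mesh bounds the moment with `δ + 2/s` in place of `δ`; then `s → ∞`
(`exists_moment_bound`). -/

noncomputable section

namespace PoissonRips


/-! ### Counting cliques and tuples of cliques -/

section Combinatorics

open scoped Classical in
/-- The `k`-element sets of points with property `φ` that are pairwise related by `R`. -/
def cliques {ι : Type*} [Fintype ι] (R : ι → ι → Prop) (φ : ι → Prop) (k : ℕ) :
    Finset (Finset ι) :=
  (Finset.univ.powersetCard k).filter fun A => ∀ a ∈ A, φ a ∧ ∀ b ∈ A, R a b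

theorem mem_cliques {ι : Type*} [Fintype ι] {R : ι → ι → Prop} {φ : ι → Prop} {k : ℕ}
    {A : Finset ι} : A ∈ cliques R φ k ↔ A.card = k ∧ ∀ a ∈ A, φ a ∧ ∀ b ∈ A, R a b := by
  simp [cliques, Finset.mem_powersetCard]

theorem card_cliques_comp_equiv {ι κ : Type*} [Fintype ι] [Fintype κ] (e : ι ≃ κ)
    (R : κ → κ → Prop) (φ : κ → Prop) (k : ℕ) :
    (cliques (fun a b => R (e a) (e b)) (fun a => φ (e a)) k).card = (cliques R φ k).card := by
  refine Finset.card_bij (fun A _ => A.map e.toEmbedding) ?_ ?_ ?_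
  · intro A hA
    rw [mem_cliques] at hA ⊢
    refine ⟨by simpa using hA.1, fun a ha => ?_⟩
    obtain ⟨a', ha', rfl⟩ := Finset.mem_map.1 ha
    refine ⟨(hA.2 a' ha').1, fun b hb => ?_⟩
    obtain ⟨b', hb', rfl⟩ := Finset.mem_map.1 hb
    exact (hA.2 a' ha').2 b' hb'
  · intro A _ B _ h
    exact Finset.map_injective _ h
  · intro B hB
    refine ⟨B.map e.symm.toEmbedding, ?_, ?_⟩
    · rw [mem_cliques] at hB ⊢
      refine ⟨by simpa using hB.1, fun a ha => ?_⟩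
      obtain ⟨a', ha', rfl⟩ := Finset.mem_map.1 ha
      refine ⟨by simpa using (hB.2 a' ha').1, fun b hb => ?_⟩
      obtain ⟨b', hb', rfl⟩ := Finset.mem_map.1 hb
      simpa using (hB.2 a' ha').2 b' hb'
    · ext; simp

theorem cliques_mono {ι : Type*} [Fintype ι] {R R' : ι → ι → Prop} {φ φ' : ι → Prop} {k : ℕ}
    (hR : ∀ a b, R a b → R' a b) (hφ : ∀ a, φ a → φ' a) : cliques R φ k ⊆ cliques R' φ' k := by
  intro A hA
  rw [mem_cliques] at hA ⊢
  exact ⟨hA.1, fun a ha => ⟨hφ a (hA.2 a ha).1, fun b hb => hR a b ((hA.2 a ha).2 b hb)⟩⟩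

-- Cliques avoiding the new point `none` are old cliques; deleting `none` from the others leaves a
-- clique among its neighbours. This is the combinatorial form of the add-one cost.
open scoped Classical in
theorem card_cliques_option {ι : Type*} [Fintype ι] (R : Option ι → Option ι → Prop)
    (φ : Option ι → Prop) (hR : R none none) (hs : ∀ a, R (some a) none ↔ R none (some a)) (k : ℕ) :
    (cliques R φ (k + 1)).card =
      (cliques (fun a b => R (some a) (some b)) (fun a => φ (some a)) (k + 1)).card +
      if φ none then (cliques (fun a b => R (some a) (some b))
        (fun a => φ (some a) ∧ R none (some a)) k).card else 0 := by
  rw [← Finset.card_filter_add_card_filter_not (s := cliques R φ (k + 1)) (fun A => none ∉ A)]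
  congr 1
  · symm
    refine Finset.card_bij (fun A _ => A.map Function.Embedding.some) ?_ ?_ ?_
    · intro A hA
      rw [mem_cliques] at hA
      rw [Finset.mem_filter, mem_cliques]
      simpa using hA
    · intro A _ B _ h
      exact Finset.map_injective _ h
    · intro B hB
      rw [Finset.mem_filter, mem_cliques] at hB
      obtain ⟨⟨h1, h2⟩, h3⟩ := hB
      have h4 : (Finset.eraseNone B).map Function.Embedding.some = B := by
        rw [Finset.map_some_eraseNone, Finset.erase_eq_of_notMem h3]
      refine ⟨Finset.eraseNone B, ?_, h4⟩
      rw [mem_cliques]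
      refine ⟨by rw [← h1, ← h4, Finset.card_map, h4], fun a ha => ?_⟩
      rw [Finset.mem_eraseNone] at ha
      exact ⟨(h2 _ ha).1, fun b hb => (h2 _ ha).2 _ (Finset.mem_eraseNone.1 hb)⟩
  · split_ifs with hφ
    · symm
      refine Finset.card_bij (fun A _ => Finset.insertNone A) ?_ ?_ ?_
      · intro A hA
        rw [mem_cliques] at hA
        rw [Finset.mem_filter, mem_cliques]
        refine ⟨⟨by simp [hA.1], ?_⟩, by simp⟩
        intro a ha
        obtain ⟨_, h⟩ := hA
        rcases a with _ | a
        · refine ⟨hφ, fun b hb => ?_⟩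
          rcases b with _ | b
          · exact hR
          · exact (h b (by simpa using hb)).1.2
        · have ha' : a ∈ A := by simpa using ha
          refine ⟨(h a ha').1.1, fun b hb => ?_⟩
          rcases b with _ | b
          · exact (hs a).2 (h a ha').1.2
          · exact (h a ha').2 b (by simpa using hb)
      · intro A _ B _ h
        exact Finset.insertNone.injective h
      · intro B hB
        rw [Finset.mem_filter, mem_cliques, not_not] at hB
        obtain ⟨⟨h1, h2⟩, h3⟩ := hB
        have h4 : Finset.insertNone (Finset.eraseNone B) = B := by
          rw [Finset.insertNone_eraseNone, Finset.insert_eq_of_mem h3]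
        refine ⟨Finset.eraseNone B, ?_, h4⟩
        rw [mem_cliques]
        refine ⟨?_, fun a ha => ?_⟩
        · have := congrArg Finset.card h4
          rw [Finset.card_insertNone] at this
          omega
        · rw [Finset.mem_eraseNone] at ha
          exact ⟨⟨(h2 _ ha).1, (h2 _ h3).2 _ ha⟩,
            fun b hb => (h2 _ ha).2 _ (Finset.mem_eraseNone.1 hb)⟩
    · rw [Finset.card_eq_zero, Finset.filter_eq_empty_iff]
      intro A hA h
      rw [mem_cliques] at hA
      rw [not_not] at h
      exact hφ (hA.2 _ h).1

-- Every clique is the range of exactly `n!` injective tuples; this cancels the factor `1/(k+1)!` in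
-- `simplexCount`.
open scoped Classical in
theorem card_embeddings_eq_factorial_mul {ι : Type*} [Fintype ι] (R : ι → ι → Prop) (n : ℕ) :
    (Finset.univ.filter fun y : Fin n ↪ ι => ∀ i j, R (y i) (y j)).card =
      n.factorial * (cliques R (fun _ => True) n).card := by
  rw [Finset.card_eq_sum_card_fiberwise (t := cliques R (fun _ => True) n)
    (f := fun y : Fin n ↪ ι => Finset.univ.map y)]
  · rw [Finset.sum_const_nat (m := n.factorial), mul_comm]
    intro A hA
    rw [mem_cliques] at hA
    have h1 : Fintype.card (Fin n ↪ A) = n.factorial := by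
      rw [Fintype.card_embedding_eq]; simp [hA.1, Nat.descFactorial_self]
    rw [← h1, ← Finset.card_univ]
    symm
    refine Finset.card_bij (fun y _ => y.trans (Function.Embedding.subtype _)) ?_ ?_ ?_
    · intro y _
      rw [Finset.mem_filter, Finset.mem_filter]
      refine ⟨⟨Finset.mem_univ _, fun i j => (hA.2 _ (y i).2).2 _ (y j).2⟩, ?_⟩
      apply Finset.eq_of_subset_of_card_le
      · intro a ha
        obtain ⟨i, _, rfl⟩ := Finset.mem_map.1 ha
        exact (y i).2
      · simp [hA.1]
    · intro y _ y' _ h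
      ext i
      exact congrArg (fun f : Fin n ↪ ι => f i) h
    · intro y hy
      rw [Finset.mem_filter] at hy
      have : ∀ i, y i ∈ A := fun i => by rw [← hy.2]; simp
      exact ⟨⟨fun i => ⟨y i, this i⟩, fun i j h => y.injective (congrArg Subtype.val h)⟩,
        Finset.mem_univ _, by ext; rfl⟩
  · intro y hy
    have hy : ∀ i j, R (y i) (y j) := by simpa using hy
    rw [Finset.mem_coe, mem_cliques]
    simpa using hy

open scoped Classical in
/-- The ways in which `p` sets of size `k` can cover `q` labelled points. -/
def coverPatterns (p k q : ℕ) : Finset (Fin p → Finset (Fin q)) :=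
  Finset.univ.filter fun B => (∀ i, (B i).card = k) ∧ ∀ u, ∃ i, u ∈ B i

/-- All points listed in a block of `B` have property `φ` and are related to all the points in the
same block. -/
def BlockRelated {p q : ℕ} {C : Type*} (R : C → C → Prop) (φ : C → Prop)
    (B : Fin p → Finset (Fin q)) (y : Fin q → C) : Prop :=
  ∀ i, ∀ u ∈ B i, φ (y u) ∧ ∀ w ∈ B i, R (y u) (y w)

-- Number the points of the union of a tuple of sets: the preimages of the sets form a cover
-- pattern, and pattern and numbering together recover the tuple. Each tuple arises from many
-- numberings, which only weakens the bound.
open scoped Classical in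
theorem card_tuples_le_sum_patterns {ι : Type*} [Fintype ι] (R : ι → ι → Prop) (φ : ι → Prop)
    (p k q₀ : ℕ) (T : Finset (Fin p → Finset ι)) (hT : ∀ A ∈ T, ∀ i, A i ∈ cliques R φ k)
    (hq : ∀ A ∈ T, q₀ ≤ (Finset.univ.biUnion A).card) :
    T.card ≤ ∑ q ∈ Finset.Icc q₀ (p * k), ∑ B ∈ coverPatterns p k q,
      (Finset.univ.filter fun y : Fin q ↪ ι => BlockRelated R φ B y).card := by
  have hsub : T ⊆ (Finset.Icc q₀ (p * k)).biUnion fun q => (coverPatterns p k q).biUnion fun B =>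
      (Finset.univ.filter fun y : Fin q ↪ ι => BlockRelated R φ B y).image
        fun y i => (B i).map y := by
    intro A hA
    have hA' := fun i => mem_cliques.1 (hT A hA i)
    set U := Finset.univ.biUnion A with hU
    have hAU : ∀ i, A i ⊆ U := fun i => Finset.subset_biUnion_of_mem A (Finset.mem_univ i)
    set y : Fin U.card ↪ ι := U.equivFin.symm.toEmbedding.trans (Function.Embedding.subtype _)
      with hy
    have hyU : ∀ u, y u ∈ U := fun u => (U.equivFin.symm u).2
    have hsurj : ∀ a ∈ U, ∃ u, y u = a := fun a ha => ⟨U.equivFin ⟨a, ha⟩, by simp [hy]⟩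
    have hmap : ∀ i, (Finset.univ.filter fun u => y u ∈ A i).map y = A i := by
      intro i
      ext a
      simp only [Finset.mem_map, Finset.mem_filter, Finset.mem_univ, true_and]
      constructor
      · rintro ⟨u, hu, rfl⟩; exact hu
      · intro ha
        obtain ⟨u, rfl⟩ := hsurj a (hAU i ha)
        exact ⟨u, ha, rfl⟩
    simp only [Finset.mem_biUnion, Finset.mem_image, Finset.mem_Icc]
    refine ⟨U.card, ⟨hq A hA, ?_⟩, fun i => Finset.univ.filter fun u => y u ∈ A i, ?_, y, ?_, ?_⟩
    · refine Finset.card_biUnion_le.trans ?_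
      simp [fun i => (hA' i).1]
    · simp only [coverPatterns, Finset.mem_filter, Finset.mem_univ, true_and]
      refine ⟨fun i => ?_, fun u => ?_⟩
      · rw [← (hA' i).1, ← Finset.card_map y, hmap]
      · simpa [hU] using hyU u
    · simp only [Finset.mem_filter, Finset.mem_univ, true_and, BlockRelated]
      exact fun i u hu => ⟨((hA' i).2 _ hu).1, fun w hw => ((hA' i).2 _ hu).2 _ hw⟩
    · exact funext hmap
  refine (Finset.card_le_card hsub).trans (Finset.card_biUnion_le.trans ?_)
  refine Finset.sum_le_sum fun q _ => Finset.card_biUnion_le.trans ?_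
  exact Finset.sum_le_sum fun B _ => Finset.card_image_le

theorem pow_card_eq_card_piFinset {α : Type*} (S : Finset α) (p : ℕ) :
    S.card ^ p = (Fintype.piFinset fun _ : Fin p => S).card := by
  simp [Fintype.card_piFinset]

open scoped Classical in
theorem sq_card_mul_pred_le_card_tuples {α : Type*} (S : Finset α) :
    (S.card * (S.card - 1)) ^ 2 ≤ ((Fintype.piFinset fun _ : Fin 4 => S).filter
      fun A => A 0 ≠ A 1 ∧ A 2 ≠ A 3).card := by
  have h : S.offDiag.card = S.card * (S.card - 1) := by
    rw [Finset.offDiag_card, Nat.mul_sub, mul_one]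
  rw [← h, sq, ← Finset.card_product]
  refine Finset.card_le_card_of_injOn (fun x => ![x.1.1, x.1.2, x.2.1, x.2.2]) ?_ ?_
  · intro x hx
    simp only [Finset.coe_product, Set.mem_prod, Finset.mem_coe, Finset.mem_offDiag] at hx
    simp only [Finset.coe_filter, Fintype.mem_piFinset, Set.mem_ofPred_eq]
    refine ⟨fun i => ?_, hx.1.2.2, hx.2.2.2⟩
    fin_cases i
    exacts [hx.1.1, hx.1.2.1, hx.2.1, hx.2.2.1]
  · intro x _ y _ hxy
    have h0 := congrFun hxy 0
    have h1 := congrFun hxy 1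
    have h2 := congrFun hxy 2
    have h3 := congrFun hxy 3
    simp only [Matrix.cons_val] at h0 h1 h2 h3
    ext1 <;> ext1 <;> assumption

end Combinatorics


/-! ### Lattice analogue of the volume bound -/

section LatticeCounting

open scoped Classical in
/-- The families of integers within distance `L` of `c` and of each other. -/
def closeInts (σ : Type*) [Fintype σ] (c : ℤ) (L : ℕ) : Finset (σ → ℤ) :=
  (Fintype.piFinset fun _ : σ => Finset.Icc (c - L) (c + L)).filter fun a =>
    ∀ u w, |a u - a w| ≤ L

theorem mem_closeInts {σ : Type*} [Fintype σ] {c : ℤ} {L : ℕ} {a : σ → ℤ} :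
    a ∈ closeInts σ c L ↔ (∀ u, |a u - c| ≤ L) ∧ ∀ u w, |a u - a w| ≤ L := by
  simp only [closeInts, Finset.mem_filter, Fintype.mem_piFinset, Finset.mem_Icc]
  refine and_congr_left fun _ => forall_congr' fun u => ?_
  rw [abs_le]
  constructor <;> intro h <;> constructor <;> linarith [h.1, h.2]

open scoped Classical in
/-- Either all the integers are at least `c`, or the smallest one lies in `[c - L, c]` and determines
the range of the others. -/
theorem card_closeInts_le (σ : Type*) [Fintype σ] (c : ℤ) (L : ℕ) :
    (closeInts σ c L).card ≤ (Fintype.card σ + 1) * (L + 1) ^ Fintype.card σ := by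
  -- `none` encodes offsets from `c`; `some j` marks a minimal entry, stores `c - a j` at `j` and
  -- the offsets from `a j` elsewhere. All stored values lie in `[0, L]`.
  let F : Option σ × (σ → ℤ) → (σ → ℤ) := fun x =>
    match x.1 with
    | none => fun u => c + x.2 u
    | some j => fun u => if u = j then c - x.2 j else c - x.2 j + x.2 u
  have hsub : closeInts σ c L ⊆ ((Finset.univ : Finset (Option σ)) ×ˢ
      Fintype.piFinset fun _ : σ => Finset.Icc (0 : ℤ) L).image F := by
    intro a ha
    rw [mem_closeInts] at ha
    obtain ⟨h1, h2⟩ := ha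
    simp only [abs_le] at h1 h2
    rw [Finset.mem_image]
    by_cases hc : ∀ u, c ≤ a u
    · refine ⟨(none, fun u => a u - c), ?_, ?_⟩
      · simp only [Finset.mem_product, Finset.mem_univ, true_and, Fintype.mem_piFinset,
          Finset.mem_Icc]
        intro u
        have := hc u
        have := (h1 u).2
        constructor <;> linarith
      · funext u
        simp [F]
    · push Not at hc
      obtain ⟨u₀, hu₀⟩ := hc
      have : Nonempty σ := ⟨u₀⟩
      obtain ⟨j, hj⟩ := Finite.exists_min a
      refine ⟨(some j, fun u => if u = j then c - a j else a u - a j), ?_, ?_⟩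
      · simp only [Finset.mem_product, Finset.mem_univ, true_and, Fintype.mem_piFinset,
          Finset.mem_Icc]
        intro u
        have := hj u₀
        have := (h1 j).1
        have := hj u
        have := (h2 u j).2
        split_ifs <;> constructor <;> linarith
      · funext u
        simp only [F, if_true]
        split_ifs with h
        · rw [h]; ring
        · ring
  refine (Finset.card_le_card hsub).trans (Finset.card_image_le.trans ?_)
  simp [Finset.card_product, Fintype.card_piFinset]

open scoped Classical in
/-- The families of integers whose blocks are within distance `L` of `c` and of each other. -/
def blockInts {p q : ℕ} (B : Fin p → Finset (Fin q)) (c : ℤ) (L : ℕ) : Finset (Fin q → ℤ) :=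
  (Fintype.piFinset fun _ : Fin q => Finset.Icc (c - L) (c + L)).filter
    (BlockRelated (fun a b : ℤ => |a - b| ≤ (L : ℤ)) (fun a => |a - c| ≤ L) B)

theorem mem_blockInts {p k q : ℕ} {B : Fin p → Finset (Fin q)} (hB : B ∈ coverPatterns p k q)
    {c : ℤ} {L : ℕ} {a : Fin q → ℤ} : a ∈ blockInts B c L ↔
      BlockRelated (fun a b : ℤ => |a - b| ≤ (L : ℤ)) (fun a => |a - c| ≤ L) B a := by
  simp only [blockInts, Finset.mem_filter, Fintype.mem_piFinset, Finset.mem_Icc,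
    and_iff_right_iff_imp]
  intro h u
  simp only [coverPatterns, Finset.mem_filter] at hB
  obtain ⟨i, hi⟩ := hB.2.2 u
  have := abs_le.1 (h i u hi).1
  constructor <;> linarith [this.1, this.2]

theorem prod_add_one_le_pow {r : ℕ} (n : Fin r → ℕ) :
    ∏ i, ((n i : ℝ) + 1) ≤ ((∑ i, (n i : ℝ)) / r + 1) ^ r := by
  rcases Nat.eq_zero_or_pos r with rfl | hr
  · simp
  have hr' : (0 : ℝ) < r := by exact_mod_cast hr
  have h := Real.geom_mean_le_arith_mean_weighted Finset.univ (fun _ : Fin r => (1 / r : ℝ))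
    (fun i => (n i : ℝ) + 1) (fun _ _ => by positivity) (by simp [hr'.ne'])
    (fun _ _ => by positivity)
  have h2 : ∑ i, (1 / r : ℝ) * ((n i : ℝ) + 1) = (∑ i, (n i : ℝ)) / r + 1 := by
    rw [← Finset.mul_sum, Finset.sum_add_distrib]
    simp
    field_simp
  rw [h2, Real.finsetProd_rpow _ _ (fun _ _ => by positivity)] at h
  have h3 := pow_le_pow_left₀ (by positivity) h r
  rwa [← Real.rpow_natCast, ← Real.rpow_mul (by positivity), one_div_mul_cancel hr'.ne',
    Real.rpow_one] at h3

/-- Assign every point to one block containing it and drop the constraints between different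
classes. The classes are then independent, and AM-GM bounds the product of the factors `n i + 1`
over the last `r` classes, whose sizes sum to `q - k`. -/
theorem card_blockInts_le {r k q : ℕ} {B : Fin (r + 1) → Finset (Fin q)}
    (hB : B ∈ coverPatterns (r + 1) k q) (c : ℤ) (L : ℕ) :
    ((blockInts B c L).card : ℝ) ≤
      (((k : ℝ) + 1) * (((q : ℝ) - k) / r + 1) ^ r) * ((L : ℝ) + 1) ^ q := by
  classical
  have hB' := hB
  simp only [coverPatterns, Finset.mem_filter, Finset.mem_univ, true_and] at hB'
  obtain ⟨hcard, hcov⟩ := hB'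
  choose g₀ hg₀ using hcov
  -- Block `0` has priority, so its class is all of `B 0`, of size exactly `k`; this isolates the
  -- factor `k + 1`.
  let g : Fin q → Fin (r + 1) := fun u => if u ∈ B 0 then 0 else g₀ u
  have hg : ∀ u, u ∈ B (g u) := by
    intro u
    by_cases h : u ∈ B 0
    · simp [g, h]
    · simpa [g, h] using hg₀ u
  let C : Fin (r + 1) → Type := fun i => {u : Fin q // g u = i}
  let n : Fin (r + 1) → ℕ := fun i => Fintype.card (C i)
  have hn0 : n 0 = k := by
    rw [← hcard 0]
    simp only [n, C, Fintype.card_subtype]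
    congr 1
    ext u
    simp only [Finset.mem_filter, Finset.mem_univ, true_and]
    exact ⟨fun h => by simpa [h] using hg u, fun h => by simp [g, h]⟩
  have hsum : ∑ i, n i = q := by
    have := Fintype.card_congr (Equiv.sigmaFiberEquiv g)
    rw [Fintype.card_sigma, Fintype.card_fin] at this
    exact this
  have h1 : (blockInts B c L).card ≤ ∏ i, ((n i + 1) * (L + 1) ^ n i) := by
    calc (blockInts B c L).card
        ≤ (Fintype.piFinset fun i => closeInts (C i) c L).card := by
          refine Finset.card_le_card_of_injOn (fun a i u => a u.1) ?_ ?_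
          · intro a ha
            rw [Finset.mem_coe, mem_blockInts hB] at ha
            rw [Finset.mem_coe, Fintype.mem_piFinset]
            intro i
            rw [mem_closeInts]
            have hi : ∀ u : C i, u.1 ∈ B i := fun u => by simpa [u.2] using hg u.1
            exact ⟨fun u => (ha i u.1 (hi u)).1, fun u w => (ha i u.1 (hi u)).2 w.1 (hi w)⟩
          · intro a _ a' _ h
            funext u
            exact congrFun (congrFun h (g u)) ⟨u, rfl⟩
      _ = ∏ i, (closeInts (C i) c L).card := Fintype.card_piFinset _
      _ ≤ _ := Finset.prod_le_prod' fun i _ => card_closeInts_le _ _ _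
  rw [Finset.prod_mul_distrib, Finset.prod_pow_eq_pow_sum, hsum, Fin.prod_univ_succ, hn0] at h1
  have h2 : ((blockInts B c L).card : ℝ) ≤
      (((k : ℝ) + 1) * ∏ i : Fin r, ((n i.succ : ℝ) + 1)) * ((L : ℝ) + 1) ^ q := by
    exact_mod_cast h1
  refine h2.trans ?_
  have h3 := prod_add_one_le_pow fun i : Fin r => n i.succ
  have h4 : ∑ i : Fin r, (n i.succ : ℝ) = (q : ℝ) - k := by
    rw [Fin.sum_univ_succ, hn0] at hsum
    rw [← hsum]; push_cast; ring
  rw [h4] at h3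
  gcongr

/-- The uniform distance of two lattice points is at most `L`. -/
def latticeNear {d : ℕ} (L : ℕ) (a b : Fin d → ℤ) : Prop := ∀ j, |a j - b j| ≤ (L : ℤ)

/-- For the uniform distance the constraints decouple over the coordinates, hence the `d`-th power.
-/
theorem card_blockRelated_lattice_le {r k q d : ℕ} {B : Fin (r + 1) → Finset (Fin q)}
    (hB : B ∈ coverPatterns (r + 1) k q) (c : Fin d → ℤ) (L : ℕ) (T : Finset (Fin q → Fin d → ℤ))
    (hT : ∀ v ∈ T, BlockRelated (latticeNear L) (fun a => latticeNear L a c) B v) :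
    (T.card : ℝ) ≤ ((((k : ℝ) + 1) * (((q : ℝ) - k) / r + 1) ^ r) * ((L : ℝ) + 1) ^ q) ^ d := by
  classical
  have h1 : T.card ≤ ∏ j, (blockInts B (c j) L).card := by
    rw [← Fintype.card_piFinset]
    refine Finset.card_le_card_of_injOn (fun v j u => v u j) ?_ ?_
    · intro v hv
      rw [Finset.mem_coe, Fintype.mem_piFinset]
      intro j
      rw [mem_blockInts hB]
      intro i u hu
      exact ⟨(hT v hv i u hu).1 j, fun w hw => (hT v hv i u hu).2 w hw j⟩
    · intro v _ v' _ h
      funext u j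
      exact congrFun (congrFun h j) u
  calc (T.card : ℝ) ≤ ∏ j, ((blockInts B (c j) L).card : ℝ) := by exact_mod_cast h1
    _ ≤ ∏ _j : Fin d, ((((k : ℝ) + 1) * (((q : ℝ) - k) / r + 1) ^ r) * ((L : ℝ) + 1) ^ q) :=
        Finset.prod_le_prod (fun _ _ => by positivity) fun j _ => card_blockInts_le hB _ _
    _ = _ := by simp

end LatticeCounting


/-! ### Factorial moments of independent Poisson counts -/

section PoissonMoments

open scoped NNReal

/-- The terms below `j` vanish, and shifting the index by `j` turns the rest into `r^j` times the
total Poisson mass. -/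
theorem lintegral_descFactorial_poissonMeasure (r : ℝ≥0) (j : ℕ) :
    ∫⁻ n, (n.descFactorial j : ENNReal) ∂(poissonMeasure r) = (r : ENNReal) ^ j := by
  have hterm : ∀ n, ENNReal.ofReal (Real.exp (-r) * r ^ (n + j) / (n + j).factorial) *
      ((n + j).descFactorial j : ENNReal) =
      ENNReal.ofReal (Real.exp (-r) * r ^ n / n.factorial) * (r : ENNReal) ^ j := by
    intro n
    have hr : (r : ENNReal) ^ j = ENNReal.ofReal ((r : ℝ) ^ j) := by
      rw [← NNReal.coe_pow, ENNReal.ofReal_coe_nnreal, ENNReal.coe_pow]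
    rw [hr, ← ENNReal.ofReal_natCast, ← ENNReal.ofReal_mul (by positivity),
      ← ENNReal.ofReal_mul (by positivity)]
    congr 1
    have h := Nat.factorial_mul_descFactorial (Nat.le_add_left j n)
    rw [Nat.add_sub_cancel] at h
    rw [← h]
    have h1 : (n.factorial : ℝ) ≠ 0 := by positivity
    have h2 : ((n + j).descFactorial j : ℝ) ≠ 0 := by
      intro h0
      rw [Nat.cast_eq_zero] at h0
      rw [h0, mul_zero] at h
      exact (Nat.factorial_ne_zero _) h.symm
    push_cast
    field_simp
    ring
  have hone : ∑' n : ℕ, ENNReal.ofReal (Real.exp (-r) * r ^ n / n.factorial) = 1 := by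
    rw [← ENNReal.ofReal_tsum_of_nonneg (fun n => by positivity)
      (hasSum_one_poissonMeasure r).summable, (hasSum_one_poissonMeasure r).tsum_eq,
      ENNReal.ofReal_one]
  rw [poissonMeasure, lintegral_sum_measure]
  simp only [lintegral_smul_measure, lintegral_dirac, smul_eq_mul]
  rw [← Summable.sum_add_tsum_nat_add' (k := j) ENNReal.summable]
  simp_rw [hterm]
  rw [ENNReal.tsum_mul_right, hone, one_mul, Finset.sum_eq_zero, zero_add]
  intro n hn
  rw [Nat.descFactorial_of_lt (Finset.mem_range.1 hn)]
  simp

theorem sigma_fin_ext {V : Type*} {m : V → ℕ} {a b : Σ v, Fin (m v)} (h₁ : a.1 = b.1)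
    (h₂ : (a.2 : ℕ) = b.2) : a = b := by
  obtain ⟨a, a'⟩ := a
  obtain ⟨b, b'⟩ := b
  obtain rfl : a = b := h₁
  obtain rfl : a' = b' := Fin.ext h₂
  rfl

-- An injective tuple lying over `v` amounts to an injection of each fibre of `v` into the points of
-- the corresponding cell.
open scoped Classical in
theorem card_embeddings_over {V : Type*} [Fintype V] (m : V → ℕ) {q : ℕ} (v : Fin q → V) :
    (Finset.univ.filter fun y : Fin q ↪ Σ v, Fin (m v) => (fun i => (y i).1) = v).card =
      ∏ u, (m u).descFactorial (Finset.univ.filter fun i => v i = u).card := by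
  have h1 : Fintype.card (∀ u, {i // v i = u} ↪ Fin (m u)) =
      ∏ u, (m u).descFactorial (Finset.univ.filter fun i => v i = u).card := by
    rw [Fintype.card_pi]
    refine Finset.prod_congr rfl fun u _ => ?_
    rw [Fintype.card_embedding_eq, Fintype.card_fin, Fintype.card_subtype]
  rw [← h1, ← Finset.card_univ]
  symm
  have key : ∀ (g : ∀ u, {i // v i = u} ↪ Fin (m u)) (i : Fin q) (u : V) (hi : v i = u),
      (g (v i) ⟨i, rfl⟩ : ℕ) = g u ⟨i, hi⟩ := by
    rintro g i _ rfl; rfl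
  refine Finset.card_bij (fun g _ => ⟨fun i => ⟨v i, g (v i) ⟨i, rfl⟩⟩, ?_⟩) ?_ ?_ ?_
  · intro i i' h
    have h2 : v i = v i' := congrArg Sigma.fst h
    have h3 : (g (v i) ⟨i, rfl⟩ : ℕ) = g (v i') ⟨i', rfl⟩ :=
      congrArg (fun a : Σ v, Fin (m v) => (a.2 : ℕ)) h
    rw [key g i _ h2] at h3
    exact congrArg Subtype.val ((g (v i')).injective (Fin.ext h3))
  · intro g _
    exact Finset.mem_filter.2 ⟨Finset.mem_univ _, rfl⟩
  · intro g _ g' _ h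
    funext u
    ext ⟨i, hi⟩
    have h3 : (g (v i) ⟨i, rfl⟩ : ℕ) = g' (v i) ⟨i, rfl⟩ :=
      congrArg (fun f : Fin q ↪ Σ v, Fin (m v) => ((f i).2 : ℕ)) h
    rw [← key g i u hi, ← key g' i u hi, h3]
  · intro y hy
    have hy : ∀ i, (y i).1 = v i := by
      rw [Finset.mem_filter] at hy
      exact fun i => congrFun hy.2 i
    refine ⟨fun u => ⟨fun i => Fin.cast (by rw [hy, i.2]) (y i.1).2, ?_⟩, Finset.mem_univ _, ?_⟩
    · intro i i' h
      have h3 : ((y i.1).2 : ℕ) = (y i'.1).2 := congrArg Fin.val h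
      exact Subtype.ext (y.injective (sigma_fin_ext (by rw [hy, hy, i.2, i'.2]) h3))
    · ext1 i
      exact sigma_fin_ext (hy i).symm rfl

open scoped Classical in
/-- The expected number of tuples of distinct points, for a finite collection of independent
Poisson counts. -/
theorem lintegral_card_embeddings_poisson {V : Type*} [Fintype V] {Ω : Type*} [MeasurableSpace Ω]
    {P : Measure Ω} {m : V → Ω → ℕ} (hm : ∀ v, Measurable (m v)) (hind : iIndepFun m P)
    {r : V → ℝ≥0} (hr : ∀ v, P.map (m v) = poissonMeasure (r v)) {q : ℕ} (f : (Fin q → V) → Prop) :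
    ∫⁻ ω, ((Finset.univ.filter fun y : Fin q ↪ Σ v, Fin (m v ω) => f fun i => (y i).1).card :
      ENNReal) ∂P = ∑ v ∈ Finset.univ.filter f, ∏ i, (r (v i) : ENNReal) := by
  have h1 : ∀ ω, ((Finset.univ.filter fun y : Fin q ↪ Σ v, Fin (m v ω) =>
      f fun i => (y i).1).card : ENNReal) = ∑ v ∈ Finset.univ.filter f,
        ∏ u, ((m u ω).descFactorial (Finset.univ.filter fun i => v i = u).card : ENNReal) := by
    intro ω
    rw [Finset.card_eq_sum_card_fiberwise (t := Finset.univ.filter f)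
      (f := fun (y : Fin q ↪ Σ v, Fin (m v ω)) i => (y i).1)
      (by intro y hy; simpa using hy)]
    push_cast
    refine Finset.sum_congr rfl fun v hv => ?_
    rw [Finset.mem_filter] at hv
    rw [Finset.filter_filter]
    have := card_embeddings_over (fun u => m u ω) v
    have h2 : (Finset.univ.filter fun y : Fin q ↪ Σ v, Fin (m v ω) =>
        (f fun i => (y i).1) ∧ (fun i => (y i).1) = v) =
        Finset.univ.filter fun y : Fin q ↪ Σ v, Fin (m v ω) => (fun i => (y i).1) = v := by
      ext y
      simp only [Finset.mem_filter, Finset.mem_univ, true_and, and_iff_right_iff_imp]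
      rintro rfl
      exact hv.2
    rw [h2, this]
    push_cast
    rfl
  simp_rw [h1]
  have hmeas : ∀ (u : V) (j : ℕ), Measurable fun ω => ((m u ω).descFactorial j : ENNReal) :=
    fun u j => (measurable_of_countable fun n : ℕ => (n.descFactorial j : ENNReal)).comp (hm u)
  rw [lintegral_finsetSum _ fun v _ => Finset.measurable_fun_prod _ fun u _ => hmeas u _]
  refine Finset.sum_congr rfl fun v _ => ?_
  rw [lintegral_prod_eq_prod_lintegral_of_indepFun Finset.univ
    (fun u ω => ((m u ω).descFactorial (Finset.univ.filter fun i => v i = u).card : ENNReal))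
    (hind.comp (fun u n => (n.descFactorial (Finset.univ.filter fun i => v i = u).card : ENNReal))
      fun u => measurable_of_countable _) fun u => hmeas u _]
  -- Regrouping the right-hand side by cells leaves, for each cell `u`, a power of `r u` to match
  -- with one factorial moment.
  rw [← Finset.prod_fiberwise Finset.univ v]
  refine Finset.prod_congr rfl fun u _ => ?_
  rw [← lintegral_map (f := fun n : ℕ => (n.descFactorial _ : ENNReal))
    (measurable_of_countable _) (hm u), hr, lintegral_descFactorial_poissonMeasure]
  rw [Finset.prod_congr rfl (g := fun _ => (r u : ENNReal))
    (fun i hi => by rw [(Finset.mem_filter.1 hi).2]), Finset.prod_const]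

end PoissonMoments


/-! ### Finite counting measures as sums of Dirac measures; difference operators -/

section CountingMeasures

/-- If every point were null, outer regularity would give it an open neighbourhood of mass below
`1`, hence of mass `0` by integrality; a locally null measure is zero by second countability. -/
theorem IsCountingMeasure.exists_atom {E : Type*} [MeasurableSpace E] [PseudoMetricSpace E]
    [SecondCountableTopology E] [BorelSpace E] {χ : Measure E} [IsFiniteMeasure χ]
    (h : IsCountingMeasure χ) (h0 : χ ≠ 0) : ∃ y, χ {y} ≠ 0 := by
  by_contra! hy
  refine h0 (Measure.measure_univ_eq_zero.1 (measure_null_of_locally_null _ fun y _ => ?_))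
  obtain ⟨U, hyU, hU, hlt⟩ := Set.exists_isOpen_lt_of_lt ({y} : Set E) 1
    (by rw [hy y]; exact one_pos)
  refine ⟨U, mem_nhdsWithin_of_mem_nhds (hU.mem_nhds (hyU rfl)), ?_⟩
  obtain ⟨n, hn⟩ := h.integer_valued U hU.measurableSet
  rw [hn] at hlt ⊢
  have : n < 1 := by exact_mod_cast hlt
  rw [Order.lt_one_iff] at this
  simp [this]

theorem IsCountingMeasure.restrict {E : Type*} [MeasurableSpace E] {χ : Measure E}
    (h : IsCountingMeasure χ) {B : Set E} (hB : MeasurableSet B) :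
    IsCountingMeasure (χ.restrict B) where
  sigmaFinite := by
    have := h.sigmaFinite
    infer_instance
  integer_valued := fun A hA => by
    rw [Measure.restrict_apply hA]
    exact h.integer_valued _ (hA.inter hB)

/-- A finite counting measure is a finite sum of Dirac measures. -/
theorem IsCountingMeasure.exists_sum_dirac {E : Type*} [MeasurableSpace E] [MetricSpace E]
    [SecondCountableTopology E] [BorelSpace E] {χ : Measure E} (hfin : χ Set.univ ≠ ⊤)
    (h : IsCountingMeasure χ) :
    ∃ (ι : Type) (_ : Fintype ι) (z : ι → E), χ = ∑ i, Measure.dirac (z i) := by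
  obtain ⟨n, hn⟩ : ∃ n : ℕ, χ Set.univ = n := by
    obtain ⟨n, hn⟩ := h.integer_valued _ MeasurableSet.univ
    induction n using ENat.recTopCoe with
    | top => simp [hn] at hfin
    | coe n => exact ⟨n, by simpa using hn⟩
  -- Strong induction on the total mass: restricting to the complement of an atom removes its mass
  -- `m ≥ 1`.
  induction n using Nat.strong_induction_on generalizing χ with
  | _ n ih =>
    have : IsFiniteMeasure χ := ⟨hfin.lt_top⟩
    by_cases h0 : χ = 0
    · exact ⟨Empty, inferInstance, Empty.elim, by simp [h0]⟩
    obtain ⟨y, hy⟩ := h.exists_atom h0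
    have hyn : ∀ B, MeasurableSet B → ∃ m : ℕ, χ B = m := by
      intro B hB
      obtain ⟨m, hm⟩ := h.integer_valued B hB
      induction m using ENat.recTopCoe with
      | top => exact absurd hm (by simp)
      | coe m => exact ⟨m, by simpa using hm⟩
    obtain ⟨m, hm⟩ := hyn {y} (measurableSet_singleton y)
    obtain ⟨l, hl⟩ := hyn {y}ᶜ (measurableSet_singleton y).compl
    have hsum : m + l = n := by
      have := measure_add_measure_compl (μ := χ) (measurableSet_singleton y)
      rw [hm, hl, hn] at this
      exact_mod_cast this
    have hm0 : m ≠ 0 := by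
      rintro rfl
      exact hy (by simpa using hm)
    have hr : (χ.restrict {y}ᶜ) Set.univ = l := by rw [Measure.restrict_apply_univ, hl]
    obtain ⟨ι, _, z, hz⟩ := ih l (by omega) (χ := χ.restrict {y}ᶜ) (by rw [hr]; simp)
      (h.restrict (measurableSet_singleton y).compl) hr
    refine ⟨ι ⊕ Fin m, inferInstance, Sum.elim z fun _ => y, ?_⟩
    rw [Fintype.sum_sum_type]
    simp only [Sum.elim_inl, Sum.elim_inr, Finset.sum_const, Finset.card_univ, Fintype.card_fin]
    calc χ = χ.restrict {y} + χ.restrict {y}ᶜ :=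
          (Measure.restrict_add_restrict_compl (measurableSet_singleton y)).symm
      _ = _ := by
          rw [Measure.restrict_singleton, hm, add_comm, hz]
          simp [Nat.cast_smul_eq_nsmul]

theorem sum_dirac_apply {E : Type*} [MeasurableSpace E] {ι : Type*} [Fintype ι] (z : ι → E)
    {B : Set E} (hB : MeasurableSet B) [DecidablePred fun i => z i ∈ B] :
    (∑ i, Measure.dirac (z i)) B = (Fintype.card {i // z i ∈ B} : ENNReal) := by
  classical
  rw [Measure.finsetSum_apply, Fintype.card_subtype, Finset.card_filter]
  push_cast
  refine Finset.sum_congr rfl fun i _ => ?_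
  rw [Measure.dirac_apply' _ hB]
  simp [Set.indicator_apply]

/-- The mass of `a` is the number of indices mapped to `a`, so numbering these indices gives
precisely the labels of the atoms at `a`. -/
theorem exists_equiv_atom {E : Type*} [MeasurableSpace E] [MeasurableSingletonClass E]
    {ι : Type*} [Fintype ι] (z : ι → E) :
    ∃ e : ι ≃ Atom (∑ i, Measure.dirac (z i)), ∀ i, (e i).1.1 = z i := by
  classical
  have hc : ∀ a, (∑ i, Measure.dirac (z i)) {a} = (Fintype.card {i // z i = a} : ENNReal) :=
    fun a => sum_dirac_apply z (measurableSet_singleton a)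
  let g : ∀ a, {i // z i = a} ≃ Fin (Fintype.card {i // z i = a}) := fun a => Fintype.equivFin _
  let f : ι → Atom (∑ i, Measure.dirac (z i)) := fun i =>
    ⟨(z i, g (z i) ⟨i, rfl⟩), by
      rw [hc]
      exact_mod_cast (g (z i) ⟨i, rfl⟩).2⟩
  have key : ∀ i a (hi : z i = a), (g (z i) ⟨i, rfl⟩ : ℕ) = g a ⟨i, hi⟩ := by
    rintro i _ rfl; rfl
  have hf : Function.Bijective f := by
    constructor
    · intro i j h
      have h1 : z i = z j := congrArg (fun a => a.1.1) h
      have h2 : (g (z i) ⟨i, rfl⟩ : ℕ) = g (z j) ⟨j, rfl⟩ := congrArg (fun a => a.1.2) h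
      rw [key i _ h1] at h2
      exact congrArg Subtype.val ((g (z j)).injective (Fin.ext h2))
    · rintro ⟨⟨a, n⟩, hn⟩
      have hn' : n < Fintype.card {i // z i = a} := by
        rw [hc] at hn
        exact_mod_cast hn
      obtain ⟨⟨i, hi⟩, hgi⟩ := (g a).surjective ⟨n, hn'⟩
      refine ⟨i, Subtype.ext (Prod.ext hi ?_)⟩
      change (g (z i) ⟨i, rfl⟩ : ℕ) = n
      rw [key i a hi, hgi]
  exact ⟨Equiv.ofBijective f hf, fun i => rfl⟩

open scoped Classical in
theorem closeIndicator_eq_ite {d n : ℕ} {δ : ℝ} (hδ : 0 ≤ δ) (y : Fin n → Pt d) :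
    closeIndicator δ y = if ∀ i j, ‖y i - y j‖ ≤ δ then 1 else 0 := by
  unfold closeIndicator
  split_ifs with h
  · exact Finset.prod_eq_one fun i _ => Finset.prod_eq_one fun j _ => if_pos (h j i)
  · push Not at h
    obtain ⟨i, j, hij⟩ := h
    rcases lt_trichotomy i j with hlt | rfl | hlt
    · refine Finset.prod_eq_zero (Finset.mem_univ i)
        (Finset.prod_eq_zero (Finset.mem_Ioi.2 hlt) (if_neg ?_))
      rw [norm_sub_rev]
      exact not_le.2 hij
    · simp at hij
      linarith
    · exact Finset.prod_eq_zero (Finset.mem_univ j)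
        (Finset.prod_eq_zero (Finset.mem_Ioi.2 hlt) (if_neg (not_le.2 hij)))

theorem simplexCount_sum_dirac {d : ℕ} {δ : ℝ} (hδ : 0 ≤ δ) (k : ℕ) {ι : Type*} [Fintype ι]
    (z : ι → Pt d) : simplexCount δ k (∑ i, Measure.dirac (z i)) =
      (cliques (fun a b => ‖z a - z b‖ ≤ δ) (fun _ => True) (k + 1)).card := by
  classical
  obtain ⟨e, he⟩ := exists_equiv_atom z
  let E : (Fin (k + 1) ↪ ι) ≃ DistinctTuple (∑ i, Measure.dirac (z i)) (k + 1) :=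
    { toFun := fun y => ⟨fun i => e (y i), e.injective.comp y.injective⟩
      invFun := fun y => ⟨fun i => e.symm (y.1 i), e.symm.injective.comp y.2⟩
      left_inv := fun y => by ext; simp
      right_inv := fun y => Subtype.ext (by funext i; simp) }
  have hE : ∀ y i, (E y).points i = z (y i) := fun y i => he (y i)
  unfold simplexCount
  rw [← E.tsum_eq, tsum_fintype]
  simp_rw [closeIndicator_eq_ite hδ, hE]
  rw [Finset.sum_boole, card_embeddings_eq_factorial_mul (fun a b => ‖z a - z b‖ ≤ δ)]
  have : ((k + 1).factorial : ℝ) ≠ 0 := by positivity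
  push_cast
  field_simp

theorem sum_dirac_add_dirac {E : Type*} [MeasurableSpace E] {ι : Type*} [Fintype ι] (z : ι → E)
    (x : E) : ∑ i, Measure.dirac (z i) + Measure.dirac x =
      ∑ i : Option ι, Measure.dirac (i.elim x z) := by
  rw [Fintype.sum_option, add_comm]
  rfl

theorem diffOp_simplexCount_sum_dirac {d : ℕ} {δ : ℝ} (hδ : 0 ≤ δ) (k : ℕ) {ι : Type*} [Fintype ι]
    (z : ι → Pt d) (x : Pt d) : diffOp x (simplexCount δ k) (∑ i, Measure.dirac (z i)) =
      (cliques (fun a b => ‖z a - z b‖ ≤ δ) (fun a => ‖x - z a‖ ≤ δ) k).card := by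
  rw [diffOp, sum_dirac_add_dirac, simplexCount_sum_dirac hδ, simplexCount_sum_dirac hδ,
    card_cliques_option _ _ (by simpa using hδ) (fun a => by simp [norm_sub_rev])]
  simp

-- The difference is taken of the count of cliques near `x₂`: adding `x₁` contributes only if `x₁`
-- itself is close to `x₂`.
open scoped Classical in
theorem diffOp₂_simplexCount_sum_dirac {d : ℕ} {δ : ℝ} (hδ : 0 ≤ δ) (k : ℕ) {ι : Type*}
    [Fintype ι] (z : ι → Pt d) (x₁ x₂ : Pt d) :
    diffOp₂ x₁ x₂ (simplexCount δ (k + 1)) (∑ i, Measure.dirac (z i)) =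
      if ‖x₁ - x₂‖ ≤ δ then ((cliques (fun a b => ‖z a - z b‖ ≤ δ)
        (fun a => ‖x₂ - z a‖ ≤ δ ∧ ‖x₁ - z a‖ ≤ δ) k).card : ℝ) else 0 := by
  rw [diffOp₂, diffOp, sum_dirac_add_dirac, diffOp_simplexCount_sum_dirac hδ,
    diffOp_simplexCount_sum_dirac hδ,
    card_cliques_option _ _ (by simpa using hδ) (fun a => by simp [norm_sub_rev])]
  by_cases h : ‖x₁ - x₂‖ ≤ δ
  · rw [if_pos h, if_pos (show ‖x₂ - (none : Option ι).elim x₁ z‖ ≤ δ by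
      rw [norm_sub_rev]; exact h)]
    simp
  · rw [if_neg h, if_neg (show ¬ ‖x₂ - (none : Option ι).elim x₁ z‖ ≤ δ by
      rw [norm_sub_rev]; exact h)]
    simp

end CountingMeasures


/-! ### Counts of a Poisson process as natural-number variables -/

section ProcessCounts

variable {E : Type*} [MeasurableSpace E] {Ω : Type*} [MeasurableSpace Ω]
  {P : Measure Ω} {η : Ω → Measure E} {μ : Measure E}

theorem IsPoissonPointProcess.measurable_apply (h : IsPoissonPointProcess P η μ) {B : Set E}
    (hB : MeasurableSet B) : Measurable fun ω => η ω B :=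
  (Measure.measurable_coe hB).comp h.measurable

theorem IsPoissonPointProcess.ae_exists_nat [IsProbabilityMeasure P]
    (h : IsPoissonPointProcess P η μ) {B : Set E} (hB : MeasurableSet B) (hμ : μ B ≠ ⊤) :
    ∀ᵐ ω ∂P, ∃ n : ℕ, η ω B = n := by
  have hmeas : ∀ n : ℕ, MeasurableSet {ω | η ω B = n} := fun n =>
    h.measurable_apply hB (measurableSet_singleton (n : ENNReal))
  have h1 : P (⋃ n : ℕ, {ω | η ω B = n}) = 1 := by
    rw [measure_iUnion _ hmeas]
    · simp_rw [h.poisson B hB, if_neg hμ]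
      have : (poissonMeasure (μ B).toNNReal) (⋃ n : ℕ, {n}) = 1 := by
        rw [Set.iUnion_of_singleton, measure_univ]
      rw [← this, measure_iUnion _ fun n => measurableSet_singleton n]
      intro i j hij
      simpa using hij
    · intro i j hij
      refine Set.disjoint_left.2 fun ω hi hj => hij ?_
      have : (i : ENNReal) = j := by
        rw [← (hi : η ω B = i), ← (hj : η ω B = j)]
      exact_mod_cast this
  have h2 := (prob_compl_eq_zero_iff (MeasurableSet.iUnion hmeas)).2 h1
  rw [ae_iff]
  convert! h2 using 2
  ext ω
  simp

/-- The number of points of `χ` in `B`, as a natural number. -/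
def pointCount (χ : Measure E) (B : Set E) : ℕ := ⌊(χ B).toReal⌋₊

theorem pointCount_of_eq {χ : Measure E} {B : Set E} {n : ℕ} (h : χ B = n) :
    pointCount χ B = n := by
  simp [pointCount, h]

theorem measurable_floor_toReal : Measurable fun a : ENNReal => ⌊a.toReal⌋₊ :=
  Nat.measurable_floor.comp ENNReal.measurable_toReal

theorem IsPoissonPointProcess.measurable_pointCount (h : IsPoissonPointProcess P η μ) {B : Set E}
    (hB : MeasurableSet B) : Measurable fun ω => pointCount (η ω) B :=
  measurable_floor_toReal.comp (h.measurable_apply hB)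

theorem IsPoissonPointProcess.map_pointCount [IsProbabilityMeasure P]
    (h : IsPoissonPointProcess P η μ) {B : Set E} (hB : MeasurableSet B) (hμ : μ B ≠ ⊤) :
    P.map (fun ω => pointCount (η ω) B) = poissonMeasure (μ B).toNNReal := by
  refine Measure.ext_of_singleton fun n => ?_
  rw [Measure.map_apply (h.measurable_pointCount hB) (measurableSet_singleton n),
    ← if_neg (c := μ B = ⊤) (t := (0 : ENNReal)) (e := poissonMeasure (μ B).toNNReal {n}) hμ,
    ← h.poisson B hB n]
  refine measure_congr ?_
  filter_upwards [h.ae_exists_nat hB hμ] with ω ⟨l, hl⟩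
  refine propext ?_
  change pointCount (η ω) B = n ↔ η ω B = n
  rw [pointCount_of_eq hl, hl, Nat.cast_inj]

theorem IsPoissonPointProcess.iIndepFun_pointCount (h : IsPoissonPointProcess P η μ)
    {V : Type*} [Fintype V] (B : V → Set E) (hB : ∀ v, MeasurableSet (B v))
    (hd : Pairwise fun v w => Disjoint (B v) (B w)) :
    iIndepFun (fun v ω => pointCount (η ω) (B v)) P := by
  let e := Fintype.equivFin V
  have h1 := h.indep _ (fun i => B (e.symm i)) (fun i => hB _)
    (fun i j hij => hd (e.symm.injective.ne hij))
  have h2 := h1.precomp e.injective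
  have h3 := h2.comp (fun _ a => ⌊a.toReal⌋₊) fun _ => measurable_floor_toReal
  simpa [Function.comp_def, pointCount] using h3

end ProcessCounts

/-! ### Discretisation of the window -/

section Cells

/-- The index of the lattice cell of side length `1 / s` that contains `y`. -/
def cell {d : ℕ} (s : ℕ) (y : Pt d) : Fin d → ℤ := fun j => ⌊y j * s⌋

/-- The part of the window in the cell with index `c`. -/
def windowCell {d : ℕ} (s : ℕ) (c : Fin d → ℤ) : Set (Pt d) := window d ∩ cell s ⁻¹' {c}

/-- The indices of the cells of side length `1 / s` that meet the window. -/
abbrev CellIndex (d s : ℕ) : Type :=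
  {c : Fin d → ℤ // c ∈ Fintype.piFinset fun _ : Fin d => Finset.Icc (-(s : ℤ)) s}

theorem measurable_cell {d : ℕ} (s : ℕ) : Measurable (cell s : Pt d → Fin d → ℤ) :=
  measurable_pi_lambda _ fun j => Int.measurable_floor.comp ((measurable_pi_apply j).mul_const _)

theorem measurableSet_window (d : ℕ) : MeasurableSet (window d) := measurableSet_Icc

theorem measurableSet_windowCell {d : ℕ} (s : ℕ) (c : Fin d → ℤ) :
    MeasurableSet (windowCell s c) :=
  (measurableSet_window d).inter (measurable_cell s (measurableSet_singleton c))

theorem cell_mem_of_mem_window {d : ℕ} (s : ℕ) {y : Pt d} (hy : y ∈ window d) :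
    cell s y ∈ Fintype.piFinset fun _ : Fin d => Finset.Icc (-(s : ℤ)) s := by
  rw [Fintype.mem_piFinset]
  intro j
  have h1 : -(1 / 2 : ℝ) ≤ y j := hy.1 j
  have h2 : y j ≤ (1 / 2 : ℝ) := hy.2 j
  have hs : (0 : ℝ) ≤ s := Nat.cast_nonneg s
  rw [Finset.mem_Icc, cell]
  constructor
  · rw [Int.le_floor]
    push_cast
    nlinarith
  · have : (⌊y j * s⌋ : ℝ) ≤ s := (Int.floor_le _).trans (by nlinarith)
    exact_mod_cast this

theorem volume_windowCell_le {d : ℕ} {s : ℕ} (hs : 0 < s) (c : Fin d → ℤ) :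
    volume (windowCell s c) ≤ ENNReal.ofReal ((1 / (s : ℝ)) ^ d) := by
  have hs' : (0 : ℝ) < s := by exact_mod_cast hs
  have hsub : windowCell s c ⊆ Set.pi Set.univ fun j => Set.Ico ((c j : ℝ) / s) ((c j + 1) / s) := by
    rintro y ⟨_, hy⟩ j _
    have hj : ⌊y j * s⌋ = c j := congrFun hy j
    rw [Int.floor_eq_iff] at hj
    rw [Set.mem_Ico, div_le_iff₀ hs', lt_div_iff₀ hs']
    exact hj
  refine (measure_mono hsub).trans ?_
  rw [volume_pi_pi]
  simp only [Real.volume_Ico, ← sub_div, add_sub_cancel_left]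
  rw [Finset.prod_const, Finset.card_univ, Fintype.card_fin, ENNReal.ofReal_pow (by positivity)]

/-- A lattice distance that is implied by the distance `δ` for points in cells of side
length `1 / s`. -/
def latticeRadius (s : ℕ) (δ : ℝ) : ℕ := ⌊δ * s⌋₊ + 1

theorem latticeNear_of_norm_le {d : ℕ} (s : ℕ) {δ : ℝ} {y y' : Pt d}
    (h : ‖y - y'‖ ≤ δ) : latticeNear (latticeRadius s δ) (cell s y) (cell s y') := by
  intro j
  have hj : |y j - y' j| ≤ δ := (norm_le_pi_norm (y - y') j).trans h
  have hs : (0 : ℝ) ≤ s := Nat.cast_nonneg s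
  rw [abs_le] at hj
  have a1 := Int.floor_le (y j * s)
  have a2 := Int.lt_floor_add_one (y j * s)
  have b1 := Int.floor_le (y' j * s)
  have b2 := Int.lt_floor_add_one (y' j * s)
  have c1 := Nat.lt_floor_add_one (δ * s)
  have d1 : (y j - y' j) * s ≤ δ * s := mul_le_mul_of_nonneg_right hj.2 hs
  have d2 : -(δ * s) ≤ (y j - y' j) * s := by nlinarith [hj.1]
  simp only [cell, latticeRadius]
  rw [abs_le]
  push_cast
  constructor
  -- Rounding costs less than `1` and `δ * s < ⌊δ * s⌋₊ + 1`; the strict bound by `⌊δ * s⌋₊ + 2`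
  -- between integers yields the bound by `latticeRadius`.
  · have : (-(((⌊δ * s⌋₊ : ℤ) + 1) + 1) : ℝ) < ((⌊y j * s⌋ - ⌊y' j * s⌋ : ℤ) : ℝ) := by
      push_cast; linarith
    have : -(((⌊δ * s⌋₊ : ℤ) + 1) + 1) < ⌊y j * s⌋ - ⌊y' j * s⌋ := by exact_mod_cast this
    linarith
  · have : ((⌊y j * s⌋ - ⌊y' j * s⌋ : ℤ) : ℝ) < (((⌊δ * s⌋₊ : ℤ) + 1) + 1 : ℝ) := by
      push_cast; linarith
    have : ⌊y j * s⌋ - ⌊y' j * s⌋ < ((⌊δ * s⌋₊ : ℤ) + 1) + 1 := by exact_mod_cast this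
    linarith

theorem latticeRadius_add_one_le {s : ℕ} (hs : 0 < s) {δ : ℝ} (hδ : 0 ≤ δ) :
    1 / (s : ℝ) * (latticeRadius s δ + 1) ≤ δ + 2 / s := by
  have hs' : (0 : ℝ) < s := by exact_mod_cast hs
  have := Nat.floor_le (show 0 ≤ δ * s by positivity)
  rw [latticeRadius, one_div_mul_eq_div, div_le_iff₀ hs', add_mul, div_mul_cancel₀ _ hs'.ne']
  push_cast
  linarith

theorem norm_le_of_latticeNear {d : ℕ} {s : ℕ} (hs : 0 < s) {δ : ℝ} (hδ : 0 ≤ δ) {y y' : Pt d}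
    (h : latticeNear (latticeRadius s δ) (cell s y) (cell s y')) : ‖y - y'‖ ≤ δ + 2 / s := by
  have hs' : (0 : ℝ) < s := by exact_mod_cast hs
  rw [pi_norm_le_iff_of_nonneg (by positivity)]
  intro j
  have hj : ((|⌊y j * s⌋ - ⌊y' j * s⌋| : ℤ) : ℝ) ≤ latticeRadius s δ := by exact_mod_cast h j
  push_cast at hj
  rw [abs_le] at hj
  have a1 := Int.floor_le (y j * s)
  have a2 := Int.lt_floor_add_one (y j * s)
  have b1 := Int.floor_le (y' j * s)
  have b2 := Int.lt_floor_add_one (y' j * s)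
  refine le_trans ?_ (latticeRadius_add_one_le hs hδ)
  rw [Pi.sub_apply, Real.norm_eq_abs, one_div_mul_eq_div, le_div_iff₀ hs', ← abs_of_pos hs',
    ← abs_mul, abs_le]
  constructor <;> nlinarith

theorem eventually_latticeNear_iff {d : ℕ} {δ : ℝ} (hδ : 0 ≤ δ) (y y' : Pt d) :
    ∀ᶠ n : ℕ in Filter.atTop,
      (latticeNear (latticeRadius (n + 1) δ) (cell (n + 1) y) (cell (n + 1) y') ↔ ‖y - y'‖ ≤ δ) := by
  by_cases h : ‖y - y'‖ ≤ δ
  · exact Filter.Eventually.of_forall fun n => iff_of_true (latticeNear_of_norm_le _ h) h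
  · have hlim : Filter.Tendsto (fun n : ℕ => δ + 2 / ((n : ℝ) + 1)) Filter.atTop (nhds (δ + 0)) :=
      tendsto_const_nhds.add
        ((Filter.tendsto_add_atTop_iff_nat 1).2 (tendsto_const_div_atTop_nhds_zero_nat (2 : ℝ)) |>.congr
          fun n => by push_cast; rfl)
    rw [add_zero] at hlim
    filter_upwards [hlim.eventually_lt_const (not_le.1 h)] with n hn
    refine iff_of_false (fun hc => ?_) h
    have := norm_le_of_latticeNear (Nat.succ_pos n) hδ hc
    push_cast at this
    linarith

end Cells


/-! ### Moment bounds for the discretised counts -/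

section MomentBounds

/-- `H` is bounded by the number of `p`-tuples of `k`-element sets, taken from a given
collection, whose union has at least `q₀` elements. -/
def CountsTuples (H : ℕ → ℕ) (p k q₀ : ℕ) : Prop :=
  ∀ (ι : Type) [Fintype ι] [DecidableEq ι] (S : Finset (Finset ι)), (∀ A ∈ S, A.card = k) →
    ∃ T : Finset (Fin p → Finset ι), (∀ A ∈ T, ∀ i, A i ∈ S) ∧
      (∀ A ∈ T, q₀ ≤ (Finset.univ.biUnion A).card) ∧ H S.card ≤ T.card

theorem countsTuples_pow (p k : ℕ) (hp : 0 < p) : CountsTuples (fun n => n ^ p) p k k := by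
  intro ι _ _ S hS
  refine ⟨Fintype.piFinset fun _ => S, fun A hA => Fintype.mem_piFinset.1 hA, fun A hA => ?_,
    (pow_card_eq_card_piFinset S p).le⟩
  rw [← hS _ (Fintype.mem_piFinset.1 hA ⟨0, hp⟩)]
  exact Finset.card_le_card (Finset.subset_biUnion_of_mem A (Finset.mem_univ _))

theorem countsTuples_sq_mul_pred (k : ℕ) :
    CountsTuples (fun n => (n * (n - 1)) ^ 2) 4 k (k + 1) := by
  intro ι _ _ S hS
  refine ⟨(Fintype.piFinset fun _ : Fin 4 => S).filter fun A => A 0 ≠ A 1 ∧ A 2 ≠ A 3,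
    fun A hA => Fintype.mem_piFinset.1 (Finset.mem_filter.1 hA).1, fun A hA => ?_, ?_⟩
  · obtain ⟨hA, hne, -⟩ := Finset.mem_filter.1 hA
    rw [Fintype.mem_piFinset] at hA
    -- A union with only `k` elements would coincide with every `A i`, contradicting `A 0 ≠ A 1`.
    by_contra! hlt
    have h0 : ∀ i, A i = Finset.univ.biUnion A := fun i =>
      Finset.eq_of_subset_of_card_le (Finset.subset_biUnion_of_mem A (Finset.mem_univ i))
        (by rw [hS _ (hA i)]; omega)
    exact hne ((h0 0).trans (h0 1).symm)
  · convert! sq_card_mul_pred_le_card_tuples S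

/-- The number of `k`-point cliques of the configuration `z` in which all points are close to `x₁`
and `x₂`. -/
def rootedCount {d : ℕ} (δ : ℝ) (x₁ x₂ : Pt d) (k : ℕ) {ι : Type} [Fintype ι] (z : ι → Pt d) : ℕ :=
  (cliques (fun a b => ‖z a - z b‖ ≤ δ) (fun a => ‖x₁ - z a‖ ≤ δ ∧ ‖x₂ - z a‖ ≤ δ) k).card

/-- The analogue of `rootedCount` for a configuration with `m c` points in the cell `c`. -/
def latticeCount {d s : ℕ} (L : ℕ) (c₁ c₂ : Fin d → ℤ) (k : ℕ) (m : CellIndex d s → ℕ) : ℕ :=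
  (cliques (fun a b : Σ v, Fin (m v) => latticeNear L a.1.1 b.1.1)
    (fun a => latticeNear L c₁ a.1.1 ∧ latticeNear L c₂ a.1.1) k).card

theorem latticeNear_comm {d L : ℕ} {a b : Fin d → ℤ} : latticeNear L a b ↔ latticeNear L b a :=
  forall_congr' fun j => by rw [abs_sub_comm]

/-- The numbers of points of `χ` in the cells of side length `1 / s`. -/
def cellCounts {d : ℕ} (s : ℕ) (χ : Measure (Pt d)) : CellIndex d s → ℕ :=
  fun v => pointCount χ (windowCell s v.1)

-- Lattice proximity depends only on the cells, so the points may be replaced by anonymous labels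
-- within each cell.
open scoped Classical in
theorem latticeCount_cellCounts_sum_dirac {d : ℕ} (s L k : ℕ) (c₁ c₂ : Fin d → ℤ) {ι : Type}
    [Fintype ι] (z : ι → Pt d) (hz : ∀ i, z i ∈ window d) :
    latticeCount L c₁ c₂ k (cellCounts s (∑ i, Measure.dirac (z i))) =
      (cliques (fun a b => latticeNear L (cell s (z a)) (cell s (z b)))
        (fun a => latticeNear L c₁ (cell s (z a)) ∧ latticeNear L c₂ (cell s (z a))) k).card := by
  let w : ι → CellIndex d s := fun i => ⟨cell s (z i), cell_mem_of_mem_window s (hz i)⟩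
  have hw : ∀ v, cellCounts s (∑ i, Measure.dirac (z i)) v = Fintype.card {i // w i = v} := by
    intro v
    refine pointCount_of_eq ?_
    rw [sum_dirac_apply z (measurableSet_windowCell s v.1)]
    congr 1
    refine Fintype.card_congr (Equiv.subtypeEquivRight fun i => ?_)
    rw [Subtype.ext_iff]
    exact and_iff_right (hz i)
  let e : ι ≃ Σ v, Fin (cellCounts s (∑ i, Measure.dirac (z i)) v) :=
    (Equiv.sigmaFiberEquiv w).symm.trans
      (Equiv.sigmaCongrRight fun v => Fintype.equivFinOfCardEq (hw v).symm)
  exact (card_cliques_comp_equiv e (fun a b => latticeNear L a.1.1 b.1.1)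
    (fun a => latticeNear L c₁ a.1.1 ∧ latticeNear L c₂ a.1.1) k).symm

theorem rootedCount_le_latticeCount {d : ℕ} (s k : ℕ) (δ : ℝ) (x₁ x₂ : Pt d) {ι : Type} [Fintype ι]
    (z : ι → Pt d) (hz : ∀ i, z i ∈ window d) : rootedCount δ x₁ x₂ k z ≤
      latticeCount (latticeRadius s δ) (cell s x₁) (cell s x₂) k
        (cellCounts s (∑ i, Measure.dirac (z i))) := by
  rw [latticeCount_cellCounts_sum_dirac s _ k _ _ z hz]
  exact Finset.card_le_card (cliques_mono (fun a b h => latticeNear_of_norm_le s h)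
    fun a h => ⟨latticeNear_of_norm_le s h.1, latticeNear_of_norm_le s h.2⟩)

theorem eventually_latticeCount_eq {d : ℕ} (k : ℕ) {δ : ℝ} (hδ : 0 ≤ δ) (x₁ x₂ : Pt d) {ι : Type}
    [Fintype ι] (z : ι → Pt d) (hz : ∀ i, z i ∈ window d) : ∀ᶠ n : ℕ in Filter.atTop,
      latticeCount (latticeRadius (n + 1) δ) (cell (n + 1) x₁) (cell (n + 1) x₂) k
        (cellCounts (n + 1) (∑ i, Measure.dirac (z i))) = rootedCount δ x₁ x₂ k z := by
  filter_upwards [Filter.eventually_all.2 fun a : ι => Filter.eventually_all.2 fun b : ι =>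
      eventually_latticeNear_iff hδ (z a) (z b),
    Filter.eventually_all.2 fun a : ι => eventually_latticeNear_iff hδ x₁ (z a),
    Filter.eventually_all.2 fun a : ι => eventually_latticeNear_iff hδ x₂ (z a)] with n h h1 h2
  rw [latticeCount_cellCounts_sum_dirac _ _ k _ _ z hz, rootedCount]
  simp only [h, h1, h2]

open scoped Classical in
theorem lintegral_latticeCount_le {H : ℕ → ℕ} {r k q₀ : ℕ}
    (hH : CountsTuples H (r + 1) k q₀) {d s L : ℕ} (c₁ c₂ : Fin d → ℤ) {Ω : Type*}
    [MeasurableSpace Ω] {P : Measure Ω} {m : CellIndex d s → Ω → ℕ} (hm : ∀ v, Measurable (m v))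
    (hind : iIndepFun m P) {ρ : CellIndex d s → NNReal}
    (hr : ∀ v, P.map (m v) = poissonMeasure (ρ v)) {b : ℝ} (hb : 0 ≤ b)
    (hρ : ∀ v, (ρ v : ENNReal) ≤ ENNReal.ofReal b) :
    ∫⁻ ω, (H (latticeCount L c₁ c₂ k fun v => m v ω) : ENNReal) ∂P ≤
      ENNReal.ofReal (∑ q ∈ Finset.Icc q₀ ((r + 1) * k), ∑ _B ∈ coverPatterns (r + 1) k q, b ^ q *
        ((((k : ℝ) + 1) * (((q : ℝ) - k) / r + 1) ^ r) * ((L : ℝ) + 1) ^ q) ^ d) := by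
  have hpt : ∀ ω, (H (latticeCount L c₁ c₂ k fun v => m v ω) : ENNReal) ≤
      ∑ q ∈ Finset.Icc q₀ ((r + 1) * k), ∑ B ∈ coverPatterns (r + 1) k q,
        ((Finset.univ.filter fun y : Fin q ↪ Σ v, Fin (m v ω) =>
          BlockRelated (latticeNear L) (fun a => latticeNear L a c₁) B fun i => (y i).1.1).card :
          ENNReal) := by
    intro ω
    obtain ⟨T, hT, hq, hle⟩ := hH _ (cliques
      (fun a b : Σ v, Fin (m v ω) => latticeNear L a.1.1 b.1.1)
      (fun a => latticeNear L c₁ a.1.1 ∧ latticeNear L c₂ a.1.1) k)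
      (fun A hA => (mem_cliques.1 hA).1)
    -- Only the closeness to `c₁` is kept; the second root is not needed for the bound.
    have h1 := card_tuples_le_sum_patterns (fun a b : Σ v, Fin (m v ω) => latticeNear L a.1.1 b.1.1)
      (fun a => latticeNear L a.1.1 c₁) (r + 1) k q₀ T
      (fun A hA i => cliques_mono (fun _ _ h => h) (fun a h => latticeNear_comm.1 h.1) (hT A hA i))
      (by convert! hq)
    exact_mod_cast hle.trans h1
  refine (lintegral_mono hpt).trans ?_
  have hmeas : ∀ (q : ℕ) (B : Fin (r + 1) → Finset (Fin q)), Measurable fun ω =>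
      ((Finset.univ.filter fun y : Fin q ↪ Σ v, Fin (m v ω) =>
          BlockRelated (latticeNear L) (fun a => latticeNear L a c₁) B fun i => (y i).1.1).card :
          ENNReal) := by
    intro q B
    exact (measurable_of_countable fun m : CellIndex d s → ℕ =>
      ((Finset.univ.filter fun y : Fin q ↪ Σ v, Fin (m v) =>
          BlockRelated (latticeNear L) (fun a => latticeNear L a c₁) B fun i => (y i).1.1).card :
          ENNReal)).comp (measurable_pi_lambda (fun ω v => m v ω) hm)
  rw [lintegral_finsetSum _ fun q _ => Finset.measurable_fun_sum _ fun B _ => hmeas q B]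
  have hterm : ∀ (q : ℕ) (B : Fin (r + 1) → Finset (Fin q)), B ∈ coverPatterns (r + 1) k q →
      ∫⁻ ω, ((Finset.univ.filter fun y : Fin q ↪ Σ v, Fin (m v ω) =>
          BlockRelated (latticeNear L) (fun a => latticeNear L a c₁) B fun i => (y i).1.1).card :
          ENNReal) ∂P ≤ ENNReal.ofReal (b ^ q *
        ((((k : ℝ) + 1) * (((q : ℝ) - k) / r + 1) ^ r) * ((L : ℝ) + 1) ^ q) ^ d) := by
    intro q B hB
    rw [lintegral_card_embeddings_poisson hm hind hr fun v =>
      BlockRelated (latticeNear L) (fun a => latticeNear L a c₁) B fun i => (v i).1]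
    set T := Finset.univ.filter fun v : Fin q → CellIndex d s =>
      BlockRelated (latticeNear L) (fun a => latticeNear L a c₁) B fun i => (v i).1 with hTdef
    have hcard : (T.card : ℝ) ≤
        ((((k : ℝ) + 1) * (((q : ℝ) - k) / r + 1) ^ r) * ((L : ℝ) + 1) ^ q) ^ d := by
      have hinj : Function.Injective fun (v : Fin q → CellIndex d s) i => (v i).1 :=
        fun v w h => funext fun i => Subtype.ext (congrFun h i)
      rw [← Finset.card_image_of_injective T hinj]
      refine card_blockRelated_lattice_le hB c₁ L _ fun v hv => ?_
      obtain ⟨w, hw, rfl⟩ := Finset.mem_image.1 hv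
      exact (Finset.mem_filter.1 hw).2
    calc ∑ v ∈ T, ∏ i, (ρ (v i) : ENNReal) ≤ ∑ _v ∈ T, ENNReal.ofReal b ^ q := by
          refine Finset.sum_le_sum fun v _ => ?_
          refine (Finset.prod_le_prod' fun i _ => hρ (v i)).trans ?_
          simp
      _ = ENNReal.ofReal (b ^ q * T.card) := by
          rw [Finset.sum_const, nsmul_eq_mul, ENNReal.ofReal_mul (by positivity),
            ENNReal.ofReal_pow hb, ENNReal.ofReal_natCast, mul_comm]
      _ ≤ _ := ENNReal.ofReal_le_ofReal (by gcongr)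
  -- A pattern has a block of size `k` inside `Fin q`, so `q - k` is nonnegative whenever the sum
  -- over patterns is nonempty.
  have hnn : ∀ q, (coverPatterns (r + 1) k q).Nonempty → 0 ≤ b ^ q *
      ((((k : ℝ) + 1) * (((q : ℝ) - k) / r + 1) ^ r) * ((L : ℝ) + 1) ^ q) ^ d := by
    rintro q ⟨B, hB⟩
    simp only [coverPatterns, Finset.mem_filter] at hB
    have h1 : (k : ℝ) ≤ q := by
      have := Finset.card_le_univ (B 0)
      rw [hB.2.1 0, Fintype.card_fin] at this
      exact_mod_cast this
    have h2 : (0 : ℝ) ≤ q - k := by linarith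
    positivity
  rw [ENNReal.ofReal_sum_of_nonneg fun q _ => Finset.sum_nonneg fun B hB => hnn q ⟨B, hB⟩]
  refine Finset.sum_le_sum fun q _ => ?_
  rw [lintegral_finsetSum _ fun B _ => hmeas q B,
    ENNReal.ofReal_sum_of_nonneg fun B hB => hnn q ⟨B, hB⟩]
  exact Finset.sum_le_sum fun B hB => hterm q B hB

end MomentBounds


/-! ### Passage from the grid to the process -/

section WindowProcess

theorem volume_window (d : ℕ) : volume (window d) = 1 := by
  rw [window, Real.volume_Icc_pi]
  norm_num

/-- The intensity has finite total mass and none outside the window, so almost surely the total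
count is finite and all points lie in the window. -/
theorem IsWindowProcess.ae_exists_sum_dirac {d : ℕ} {Ω : Type*} [MeasurableSpace Ω]
    {P : Measure Ω} [IsProbabilityMeasure P] {η : Ω → Measure (Pt d)} {t : ℝ}
    (h : IsWindowProcess P η t) : ∀ᵐ ω ∂P, ∃ (ι : Type) (_ : Fintype ι) (z : ι → Pt d),
      (∀ i, z i ∈ window d) ∧ η ω = ∑ i, Measure.dirac (z i) := by
  have hW := measurableSet_window d
  have hout : (ENNReal.ofReal t • (volume : Measure (Pt d)).restrict (window d)) (window d)ᶜ = 0 := by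
    simp [Measure.restrict_apply hW.compl]
  have h1 : ∀ᵐ ω ∂P, ∃ n : ℕ, η ω Set.univ = n := by
    refine h.ae_exists_nat MeasurableSet.univ ?_
    simp [volume_window]
  have h2 : ∀ᵐ ω ∂P, η ω (window d)ᶜ = 0 := by
    have hP := h.poisson _ hW.compl 0
    rw [hout] at hP
    have hmeas : MeasurableSet {ω | η ω (window d)ᶜ = 0} :=
      h.measurable_apply hW.compl (measurableSet_singleton 0)
    rw [ae_iff]
    refine (prob_compl_eq_zero_iff hmeas).2 ?_
    simpa [poissonMeasure_singleton] using hP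
  filter_upwards [h1, h2] with ω ⟨n, hn⟩ hω
  obtain ⟨ι, _, z, hz⟩ := (h.counting ω).exists_sum_dirac (by rw [hn]; simp)
  refine ⟨ι, inferInstance, z, fun i => ?_, hz⟩
  by_contra hi
  rw [hz, Measure.finsetSum_apply, Finset.sum_eq_zero_iff] at hω
  have := hω i (Finset.mem_univ i)
  rw [Measure.dirac_apply' _ hW.compl, Set.indicator_of_mem (by exact hi)] at this
  exact one_ne_zero this

/-- The cell volumes `(1/s)^d` and the lattice counts `(L+1)^d` combine, since `(L+1)/s ≤ δ + 2/s`
for the lattice radius `L`. -/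
theorem sum_mul_latticeRadius_le {t δ : ℝ} (ht : 0 < t) (hδ : 0 < δ) {r k q₀ q₁ d s : ℕ}
    (hk : k ≤ q₀) (hs : 0 < s) (c : ℕ → ℕ) {D : ℝ} (hD : ∀ q ∈ Finset.Icc q₀ q₁, (c q : ℝ) ≤ D) :
    ∑ q ∈ Finset.Icc q₀ q₁, (c q : ℝ) *
      ((t * (1 / (s : ℝ)) ^ d) ^ q * ((((k : ℝ) + 1) * (((q : ℝ) - k) / r + 1) ^ r) *
        ((latticeRadius s δ : ℝ) + 1) ^ q) ^ d) ≤
    D * ∑ q ∈ Finset.Icc q₀ q₁, (t * (δ + 2 / s) ^ d) ^ q *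
        (((k : ℝ) + 1) * (((q : ℝ) - k) / r + 1) ^ r) ^ d := by
  rw [Finset.mul_sum]
  refine Finset.sum_le_sum fun q hq => ?_
  have h1 : (0 : ℝ) ≤ q - k := by
    have : k ≤ q := hk.trans (Finset.mem_Icc.1 hq).1
    rw [sub_nonneg]
    exact_mod_cast this
  have h2 := hD q hq
  have h3 := latticeRadius_add_one_le hs hδ.le
  set A := ((k : ℝ) + 1) * (((q : ℝ) - k) / r + 1) ^ r
  have hA : 0 ≤ A := by positivity
  have h4 : (t * (1 / (s : ℝ)) ^ d) ^ q * (A * ((latticeRadius s δ : ℝ) + 1) ^ q) ^ d =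
      (t * (1 / (s : ℝ) * (latticeRadius s δ + 1)) ^ d) ^ q * A ^ d := by
    generalize (latticeRadius s δ : ℝ) + 1 = x
    generalize 1 / (s : ℝ) = y
    rw [mul_pow y, mul_pow A, ← pow_mul x, mul_comm q d, pow_mul x, ← mul_assoc t,
      mul_pow (t * y ^ d)]
    ring
  rw [h4]
  have h5 : 0 ≤ D := (Nat.cast_nonneg _).trans h2
  refine mul_le_mul h2 ?_ (by positivity) h5
  gcongr

/-- Moment bounds for functions of the number of cliques around `x₁` and `x₂` in the process. -/
theorem exists_moment_bound {H : ℕ → ℕ} (hmono : Monotone H) {r k q₀ : ℕ} (hk : k ≤ q₀)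
    (hH : CountsTuples H (r + 1) k q₀) : ∃ D : ℝ, 0 < D ∧
    ∀ (d : ℕ) (t δ : ℝ), 0 < t → 0 < δ →
    ∀ (Ω : Type u) [MeasurableSpace Ω] (P : Measure Ω) [IsProbabilityMeasure P]
      (η : Ω → Measure (Pt d)), IsWindowProcess P η t →
    ∀ (x₁ x₂ : Pt d) (g : Measure (Pt d) → ℝ),
      (∀ (ι : Type) [Fintype ι] (z : ι → Pt d),
        g (∑ i, Measure.dirac (z i)) = H (rootedCount δ x₁ x₂ k z)) →
      Integrable (fun ω => g (η ω)) P ∧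
      ∫ ω, g (η ω) ∂P ≤ D * ∑ q ∈ Finset.Icc q₀ ((r + 1) * k), (t * δ ^ d) ^ q *
        (((k : ℝ) + 1) * (((q : ℝ) - k) / r + 1) ^ r) ^ d := by
  obtain ⟨c, hc⟩ : ∃ c : ℕ → ℕ, ∀ q, (coverPatterns (r + 1) k q).card = c q := ⟨_, fun _ => rfl⟩
  obtain ⟨D, hD0, hD⟩ : ∃ D : ℝ, 0 < D ∧ ∀ q ∈ Finset.Icc q₀ ((r + 1) * k), (c q : ℝ) ≤ D := by
    -- The constant involves only the numbers of patterns, hence not `d`, `t` or `δ`; the extra `1`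
    -- makes it positive in every case.
    refine ⟨∑ q ∈ Finset.Icc q₀ ((r + 1) * k), (c q : ℝ) + 1, ?_, fun q hq => ?_⟩
    · exact add_pos_of_nonneg_of_pos (Finset.sum_nonneg fun q _ => Nat.cast_nonneg _) one_pos
    · exact (Finset.single_le_sum (f := fun q => (c q : ℝ)) (fun _ _ => Nat.cast_nonneg _) hq).trans
        (le_add_of_nonneg_right zero_le_one)
  refine ⟨D, hD0, ?_⟩
  intro d t δ ht hδ Ω _ P _ η hη x₁ x₂ g hg
  let bound : ℝ → ℝ := fun ε => D * ∑ q ∈ Finset.Icc q₀ ((r + 1) * k), (t * (δ + ε) ^ d) ^ q *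
        (((k : ℝ) + 1) * (((q : ℝ) - k) / r + 1) ^ r) ^ d
  have hpos : 0 ≤ bound 0 := by
    refine mul_nonneg hD0.le (Finset.sum_nonneg fun q hq => ?_)
    have h1 : (0 : ℝ) ≤ q - k := by
      have : k ≤ q := hk.trans (Finset.mem_Icc.1 hq).1
      rw [sub_nonneg]
      exact_mod_cast this
    positivity
  let N : ℕ → Ω → ℕ := fun n ω => latticeCount (latticeRadius (n + 1) δ) (cell (n + 1) x₁)
    (cell (n + 1) x₂) k (cellCounts (n + 1) (η ω))
  have hcells : ∀ n v, Measurable fun ω => cellCounts (n + 1) (η ω) v := fun n v =>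
    hη.measurable_pointCount (measurableSet_windowCell _ _)
  have hN : ∀ n, Measurable fun ω => (H (N n ω) : ℝ) := fun n =>
    (measurable_of_countable fun m : CellIndex d (n + 1) → ℕ =>
      (H (latticeCount (latticeRadius (n + 1) δ) (cell (n + 1) x₁) (cell (n + 1) x₂) k m) : ℝ)).comp
      (measurable_pi_lambda _ (hcells n))
  have hae := hη.ae_exists_sum_dirac
  have hle : ∀ᵐ ω ∂P, 0 ≤ g (η ω) ∧ ∀ n, g (η ω) ≤ H (N n ω) := by
    filter_upwards [hae] with ω ⟨ι, _, z, hz, hω⟩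
    have h1 : g (η ω) = H (rootedCount δ x₁ x₂ k z) := by rw [hω, hg]
    refine ⟨by rw [h1]; positivity, fun n => ?_⟩
    rw [h1]
    have h2 : rootedCount δ x₁ x₂ k z ≤ N n ω := by
      simp only [N, hω]
      exact rootedCount_le_latticeCount (n + 1) k δ x₁ x₂ z hz
    exact_mod_cast hmono h2
  -- The convergence serves only to make `g (η ω)` almost everywhere measurable; the moment bound
  -- uses the domination `hle` at each mesh.
  have hlim : ∀ᵐ ω ∂P, Filter.Tendsto (fun n => (H (N n ω) : ℝ)) Filter.atTop (nhds (g (η ω))) := by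
    filter_upwards [hae] with ω ⟨ι, _, z, hz, hω⟩
    have h1 : g (η ω) = H (rootedCount δ x₁ x₂ k z) := by rw [hω, hg]
    refine tendsto_const_nhds.congr' ?_
    filter_upwards [eventually_latticeCount_eq k hδ.le x₁ x₂ z hz] with n hn
    rw [h1]
    simp only [N, hω, hn]
  have haem : AEMeasurable (fun ω => g (η ω)) P :=
    aemeasurable_of_tendsto_metrizable_ae' (fun n => (hN n).aemeasurable) hlim
  have hbn : ∀ n : ℕ, ∫⁻ ω, ENNReal.ofReal (g (η ω)) ∂P ≤
      ENNReal.ofReal (bound (2 / ((n : ℝ) + 1))) := by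
    intro n
    have hvol : ∀ v : CellIndex d (n + 1),
        (ENNReal.ofReal t • (volume : Measure (Pt d)).restrict (window d))
          (windowCell (n + 1) v.1) ≤
        ENNReal.ofReal (t * (1 / ((n + 1 : ℕ) : ℝ)) ^ d) := by
      intro v
      rw [Measure.smul_apply, smul_eq_mul, ENNReal.ofReal_mul ht.le]
      gcongr
      exact (Measure.restrict_apply_le _ _).trans (volume_windowCell_le n.succ_pos v.1)
    have hfin : ∀ v : CellIndex d (n + 1),
        (ENNReal.ofReal t • (volume : Measure (Pt d)).restrict (window d))
          (windowCell (n + 1) v.1) ≠ ⊤ := fun v =>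
      ((hvol v).trans_lt ENNReal.ofReal_lt_top).ne
    have h1 := lintegral_latticeCount_le hH (L := latticeRadius (n + 1) δ) (cell (n + 1) x₁)
      (cell (n + 1) x₂) (m := fun v ω => cellCounts (n + 1) (η ω) v) (hcells n)
      (hη.iIndepFun_pointCount (fun v : CellIndex d (n + 1) => windowCell (n + 1) v.1)
        (fun v => measurableSet_windowCell _ _) fun v w hvw => by
          refine Set.disjoint_left.2 fun y hv hw => hvw (Subtype.ext ?_)
          exact (hv.2 : cell (n + 1) y = v.1).symm.trans hw.2)
      (fun v => hη.map_pointCount (measurableSet_windowCell _ _) (hfin v))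
      (b := t * (1 / ((n + 1 : ℕ) : ℝ)) ^ d) (by positivity)
      (fun v => by rw [ENNReal.coe_toNNReal (hfin v)]; exact hvol v)
    refine le_trans (lintegral_mono_ae ?_) (h1.trans (ENNReal.ofReal_le_ofReal ?_))
    · filter_upwards [hle] with ω hω
      rw [← ENNReal.ofReal_natCast]
      exact ENNReal.ofReal_le_ofReal (hω.2 n)
    · have h2 := sum_mul_latticeRadius_le ht hδ (r := r) (d := d) hk n.succ_pos c hD
      simp only [Finset.sum_const, nsmul_eq_mul, hc]
      simpa only [bound, Nat.succ_eq_add_one, Nat.cast_add, Nat.cast_one] using h2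
  have hb0 : ∫⁻ ω, ENNReal.ofReal (g (η ω)) ∂P ≤ ENNReal.ofReal (bound 0) := by
    -- The left-hand side of `hbn` does not depend on `n`, so continuity of `bound` at `0` finishes
    -- the estimate.
    have hcont : Continuous bound := by fun_prop
    have h0 : Filter.Tendsto (fun n : ℕ => (2 : ℝ) / ((n : ℝ) + 1)) Filter.atTop (nhds 0) :=
      ((Filter.tendsto_add_atTop_iff_nat 1).2 (tendsto_const_div_atTop_nhds_zero_nat (2 : ℝ))).congr
        fun n => by push_cast; rfl
    exact ge_of_tendsto' ((ENNReal.continuous_ofReal.comp hcont).continuousAt.tendsto.comp h0) hbn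
  have hnn : 0 ≤ᵐ[P] fun ω => g (η ω) := by
    filter_upwards [hle] with ω hω using hω.1
  refine ⟨⟨haem.aestronglyMeasurable, ?_⟩, ?_⟩
  · rw [hasFiniteIntegral_iff_ofReal hnn]
    exact hb0.trans_lt ENNReal.ofReal_lt_top
  · rw [integral_eq_lintegral_of_nonneg_ae hnn haem.aestronglyMeasurable]
    have := ENNReal.toReal_le_of_le_ofReal hpos hb0
    simpa only [bound, add_zero] using this

end WindowProcess

end PoissonRips

end

/-! ### The three moment bounds -/

theorem theorem4p8 (k : ℕ) (hk : 1 ≤ k) :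
    (∀ p ∈ ({2, 3, 4} : Finset ℕ), ∃ D : ℝ, 0 < D ∧
      ∀ (d : ℕ), 1 ≤ d → ∀ (t δ : ℝ), 0 < t → 0 < δ → δ < 1 / 4 →
      ∀ (Ω : Type u) [MeasurableSpace Ω] (P : Measure Ω) [IsProbabilityMeasure P]
        (η : Ω → Measure (Pt d)), IsWindowProcess P η t →
      ∀ x ∈ window d,
        Integrable (fun ω => (diffOp x (simplexCount δ k) (η ω)) ^ p) P ∧
        ∫ ω, (diffOp x (simplexCount δ k) (η ω)) ^ p ∂P ≤
          D * ∑ q ∈ Finset.Icc k (p * k), (t * δ ^ d) ^ q *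
            (((k : ℝ) + 1) * (((q : ℝ) - k) / ((p : ℝ) - 1) + 1) ^ (p - 1)) ^ d) ∧
    (∃ D : ℝ, 0 < D ∧
      ∀ (d : ℕ), 1 ≤ d → ∀ (t δ : ℝ), 0 < t → 0 < δ → δ < 1 / 4 →
      ∀ (Ω : Type u) [MeasurableSpace Ω] (P : Measure Ω) [IsProbabilityMeasure P]
        (η : Ω → Measure (Pt d)), IsWindowProcess P η t →
      ∀ x ∈ window d,
        Integrable (fun ω => (diffOp x (simplexCount δ k) (η ω) *
          (diffOp x (simplexCount δ k) (η ω) - 1)) ^ 2) P ∧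
        ∫ ω, (diffOp x (simplexCount δ k) (η ω) *
          (diffOp x (simplexCount δ k) (η ω) - 1)) ^ 2 ∂P ≤
          D * ∑ q ∈ Finset.Icc (k + 1) (4 * k), (t * δ ^ d) ^ q *
            (((k : ℝ) + 1) * (((q : ℝ) - k) / 3 + 1) ^ 3) ^ d) ∧
    (∃ D : ℝ, 0 < D ∧
      ∀ (d : ℕ), 1 ≤ d → ∀ (t δ : ℝ), 0 < t → 0 < δ → δ < 1 / 4 →
      ∀ (Ω : Type u) [MeasurableSpace Ω] (P : Measure Ω) [IsProbabilityMeasure P]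
        (η : Ω → Measure (Pt d)), IsWindowProcess P η t →
      ∀ x₁ ∈ window d, ∀ x₂ ∈ window d,
        Integrable (fun ω => (diffOp₂ x₁ x₂ (simplexCount δ k) (η ω)) ^ 4) P ∧
        ∫ ω, (diffOp₂ x₁ x₂ (simplexCount δ k) (η ω)) ^ 4 ∂P ≤
          (if ‖x₁ - x₂‖ ≤ δ then 1 else 0) * D *
          ∑ q ∈ Finset.Icc (k - 1) (4 * (k - 1)), (t * δ ^ d) ^ q *
            ((k : ℝ) * (((q : ℝ) - ((k : ℝ) - 1)) / 3 + 1) ^ 3) ^ d) := by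

  refine ⟨fun p hp => ?_, ?_, ?_⟩
  · obtain ⟨r, rfl⟩ : ∃ r, p = r + 1 := ⟨p - 1, by
      simp only [Finset.mem_insert, Finset.mem_singleton] at hp; omega⟩
    obtain ⟨D, hD, h⟩ := exists_moment_bound.{u} (pow_left_mono (r + 1)) le_rfl
      (countsTuples_pow (r + 1) k r.succ_pos)
    refine ⟨D, hD, fun d _ t δ ht hδ _ Ω _ P _ η hη x _ => ?_⟩
    have := h d t δ ht hδ Ω P η hη x x (fun χ => diffOp x (simplexCount δ k) χ ^ (r + 1))
      fun ι _ z => by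
        rw [diffOp_simplexCount_sum_dirac hδ.le]
        simp [rootedCount]
    simpa using this
  · have hmono : Monotone fun n : ℕ => (n * (n - 1)) ^ 2 := fun a b hab => by
      dsimp only
      gcongr
    -- Truncated subtraction differs from the real one only at `n = 0`, where the factor `n`
    -- vanishes.
    have hcast : ∀ n : ℕ, ((n : ℝ) * (n - 1)) ^ 2 = (((n * (n - 1)) ^ 2 : ℕ) : ℝ) := fun n => by
      cases n <;> simp
    obtain ⟨D, hD, h⟩ := exists_moment_bound.{u} (r := 3) hmono k.le_succ
      (countsTuples_sq_mul_pred k)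
    refine ⟨D, hD, fun d _ t δ ht hδ _ Ω _ P _ η hη x _ => ?_⟩
    have := h d t δ ht hδ Ω P η hη x x
      (fun χ => (diffOp x (simplexCount δ k) χ * (diffOp x (simplexCount δ k) χ - 1)) ^ 2)
      fun ι _ z => by
        rw [diffOp_simplexCount_sum_dirac hδ.le]
        simp only [rootedCount, and_self]
        exact hcast _
    simpa using this
  · obtain ⟨k, rfl⟩ : ∃ l, k = l + 1 := ⟨k - 1, by omega⟩
    obtain ⟨D, hD, h⟩ := exists_moment_bound.{u} (r := 3) (pow_left_mono 4) le_rfl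
      (countsTuples_pow 4 k (by norm_num))
    refine ⟨D, hD, fun d _ t δ ht hδ _ Ω _ P _ η hη x₁ _ x₂ _ => ?_⟩
    by_cases hx : ‖x₁ - x₂‖ ≤ δ
    · have := h d t δ ht hδ Ω P η hη x₂ x₁
        (fun χ => diffOp₂ x₁ x₂ (simplexCount δ (k + 1)) χ ^ 4) fun ι _ z => by
          rw [diffOp₂_simplexCount_sum_dirac hδ.le, if_pos hx]
          simp [rootedCount]
      simpa [hx] using this
    -- No simplex contains two points at distance greater than `δ`, so the second difference
    -- vanishes almost surely.
    · have h0 : (fun ω => diffOp₂ x₁ x₂ (simplexCount δ (k + 1)) (η ω) ^ 4) =ᵐ[P] fun _ => 0 := by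
        filter_upwards [hη.ae_exists_sum_dirac] with ω ⟨ι, _, z, _, hω⟩
        rw [hω, diffOp₂_simplexCount_sum_dirac hδ.le, if_neg hx]
        simp
      refine ⟨(integrable_zero _ _ _).congr h0.symm, ?_⟩
      rw [integral_congr_ae h0]
      simp [hx]
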